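/- Let $n\ge 0$ and let $\lambda=(\lambda_1>\lambda_2>\dots>\lambda_n)$ be a strictly decreasing sequence of integers (a regular dominant integral weight of $\mathfrak{gl}_n$). The Gelfand–Tsetlin polytope $GT_\lambda\subset\mathbb R^{\binom{n+1}{2}}$, with coordinates $A_{i,j}$ ($0\le i\le n-1$, $1\le j\le n-i$), is given by $A_{0,j}=\lambda_j$ and $A_{i,j}\ge A_{i+1,j}\ge A_{i,j+1}$. For $P\subset\mathbb R^m$ let $S(P)=\sum_{a\in P\cap\mathbb Z^m}\mathbf t^a$ (a formal Laurent series); if $qS(P)$ is a Laurent polynomial for some Laurent polynomial $q\neq0$ with integer coefficients, let $\sigma(P)=\frac{qS(P)}{q}$, a rational function that does not depend on $q$. Let $F$ be the specialization $t_{0,j}\mapsto x_1$, $t_{i,j}\mapsto x_i^{-1}x_{i+1}$ ($i>0$); for a rational function $Q$ put $F(Q)=F(p)/F(q)$ if $Q=p/q$ with Laurent polynomials $p,q$ such that $F(q)\ne0$. A permutation $w\in S_n$ acts on rational functions in $x_1,\dots,x_n$ by $x_i\mapsto x_{w(i)}$, and $e^\lambda=x_1^{\lambda_1}\cdots x_n^{\lambda_n}$.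 For a vertex $v$ of $GT_\lambda$ let $C_v$ be the tangent cone of $GT_\lambda$ at $v$ (with apex $v$); $v$ is called simplicial if $C_v$ is a simplicial cone, i.e. is generated by linearly independent direction vectors. Then: 1. $GT_\lambda$ has exactly $n!$ simplicial vertices. 2. For every $w\in S_n$ there is exactly one simplicial vertex $v$ that is an integer point with $F(\mathbf t^v)=w(e^\lambda)$. 3. For every vertex $v$ of $GT_\lambda$ the expressions $\sigma(C_v)$ and $F(\sigma(C_v))$ are defined. 4. If $v$ is a simplicial vertex with $F(\mathbf t^v)=w(e^\lambda)$, then $$F(\sigma(C_v))=w\Bigl(\frac{e^\lambda}{\prod_{1\le i<j\le n}(1-x_j/x_i)}\Bigr).$$ 5. If $v$ is a non-simplicial vertex, then $F(\sigma(C_v))=0$. 6. Consequently, the specialization of Brion's formula for $GT_\lambda$ is Weyl's character formula: $\sigma(GT_\lambda)$ and $F(\sigma(GT_\lambda))$ are defined, $GT_\lambda$ has finitely many vertices, and $$F(\sigma(GT_\lambda))=\sum_{v\text{ vertex of }GT_\lambda}F(\sigma(C_v))=\sum_{w\in S_n}w\Bigl(\frac{e^\lambda}{\prod_{1\le i<j\le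 n}(1-x_j/x_i)}\Bigr).$$ -/

import Mathlib

noncomputable section

namespace GelfandTsetlin

/-! ### Laurent polynomials, rational functions and formal Laurent series -/

/-- Laurent polynomials with integer coefficients in variables `x k`, `k : κ`. -/
abbrev Laurent (κ : Type) : Type := AddMonoidAlgebra ℤ (κ → ℤ)

/-- The field of rational functions in the variables `x k`, `k : κ`
(the fraction field of the domain of Laurent polynomials). -/
abbrev RatFun (κ : Type) : Type := FractionRing (Laurent κ)

/-- A Laurent polynomial regarded as a rational function. -/
abbrev toRat {κ : Type} (p : Laurent κ) : RatFun κ := algebraMap (Laurent κ) (RatFun κ) p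

/-- The formal exponential `x ^ a = ∏ k, x k ^ a k` of an integer point `a`. -/
def monomial {κ : Type} (a : κ → ℤ) : Laurent κ := AddMonoidAlgebra.single a 1

/-- The variable `x k` as a rational function. -/
def var {κ : Type} [DecidableEq κ] (k : κ) : RatFun κ := toRat (monomial (Pi.single k 1))

/-- The product `q * f` of a Laurent polynomial `q` and a formal Laurent series `f`, a series
`∑ a, f a • x ^ a` being given by its family of coefficients, without any support condition. -/
def mulSeries {κ : Type} (q : Laurent κ) (f : (κ → ℤ) → ℤ) : (κ → ℤ) → ℤ :=
  fun a => q.coeff.sum fun b c => c * f (a - b)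

/-! ### Integer points and integer-point transforms -/

/-- An integer point as a point of the real space. -/
def toReal {κ : Type} (a : κ → ℤ) : κ → ℝ := fun k => (a k : ℝ)

open Classical in
/-- The generating function `S(P)`, the sum of `x ^ a` over all integer points `a` of `P`. -/
def genFun {κ : Type} (P : Set (κ → ℝ)) : (κ → ℤ) → ℤ :=
  fun a => if toReal a ∈ P then 1 else 0

/-- `Q` is the rational function `(q * S(P)) / q`, where `q` is a nonzero Laurent polynomial such
that `q * S(P)` is a Laurent polynomial `p`. -/
def IsTransform {κ : Type} (P : Set (κ → ℝ)) (Q : RatFun κ) : Prop :=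
  ∃ q p : Laurent κ, q ≠ 0 ∧ (mulSeries q (genFun P) = fun a => p.coeff a) ∧
    Q = toRat p / toRat q

open Classical in
/-- The integer-point transform `σ(P)`; it is meaningful only if `∃ Q, IsTransform P Q`
(and then it is the only such `Q`, see `IsTransform.transform_eq`). -/
def transform {κ : Type} (P : Set (κ → ℝ)) : RatFun κ :=
  if h : ∃ Q, IsTransform P Q then h.choose else 0

section Uniqueness

variable {κ : Type}

theorem mulSeries_add (q q' : Laurent κ) (f : (κ → ℤ) → ℤ) :
    mulSeries (q + q') f = mulSeries q f + mulSeries q' f := by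
  funext a
  simp only [mulSeries, Pi.add_apply, AddMonoidAlgebra.coeff_add]
  exact Finsupp.sum_add_index' (by simp) (by intros; ring)

theorem mulSeries_zero (f : (κ → ℤ) → ℤ) : mulSeries (0 : Laurent κ) f = 0 := by
  funext a
  simp [mulSeries]

theorem mulSeries_single (b : κ → ℤ) (c : ℤ) (f : (κ → ℤ) → ℤ) :
    mulSeries (AddMonoidAlgebra.single b c : Laurent κ) f = fun a => c * f (a - b) := by
  funext a
  simp [mulSeries]

theorem mulSeries_add_right (q : Laurent κ) (f g : (κ → ℤ) → ℤ) :
    mulSeries q (f + g) = mulSeries q f + mulSeries q g := by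
  funext a
  simp [mulSeries, mul_add, Finsupp.sum, Finset.sum_add_distrib]

theorem mulSeries_zero_right (q : Laurent κ) : mulSeries q (0 : (κ → ℤ) → ℤ) = 0 := by
  funext a
  simp [mulSeries]

theorem mulSeries_mul (q q' : Laurent κ) (f : (κ → ℤ) → ℤ) :
    mulSeries (q * q') f = mulSeries q (mulSeries q' f) := by
  induction q using AddMonoidAlgebra.induction_linear with
  | zero => rw [zero_mul, mulSeries_zero, mulSeries_zero]
  | add p r hp hr => rw [add_mul, mulSeries_add, hp, hr, mulSeries_add]
  | single b c =>
    induction q' using AddMonoidAlgebra.induction_linear with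
    | zero => rw [mul_zero, mulSeries_zero, mulSeries_zero_right]
    | add p r hp hr =>
      rw [mul_add, mulSeries_add, hp, hr, mulSeries_add p r, mulSeries_add_right]
    | single b' c' =>
      rw [AddMonoidAlgebra.single_mul_single, mulSeries_single, mulSeries_single,
        mulSeries_single]
      funext a
      simp only [mul_assoc, sub_sub]

theorem mulSeries_coeff (q p : Laurent κ) :
    mulSeries q (fun a => p.coeff a) = fun a => (q * p).coeff a := by
  classical
  induction q using AddMonoidAlgebra.induction_linear with
  | zero => rw [mulSeries_zero, zero_mul]; rfl
  | add r s hr hs =>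
    rw [mulSeries_add, hr, hs, add_mul]; rfl
  | single b c =>
    rw [mulSeries_single]
    funext a
    have := AddMonoidAlgebra.coeff_single_mul_add p c b (a - b)
    rw [add_sub_cancel] at this
    exact this.symm

theorem toRat_ne_zero {q : Laurent κ} (hq : q ≠ 0) : toRat q ≠ 0 := by
  simpa using hq

theorem IsTransform.unique {P : Set (κ → ℝ)} {Q Q' : RatFun κ}
    (h : IsTransform P Q) (h' : IsTransform P Q') : Q = Q' := by
  obtain ⟨q, p, hq, hS, rfl⟩ := h
  obtain ⟨q', p', hq', hS', rfl⟩ := h'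
  have key : q' * p = q * p' := by
    have e : (fun a => (q' * p).coeff a) = fun a => (q * p').coeff a := by
      rw [← mulSeries_coeff, ← mulSeries_coeff, ← hS, ← hS', ← mulSeries_mul, ← mulSeries_mul,
        mul_comm]
    exact AddMonoidAlgebra.coeff_injective (DFunLike.coe_injective e)
  rw [div_eq_div_iff (toRat_ne_zero hq) (toRat_ne_zero hq')]
  simp only [toRat, ← map_mul]
  rw [mul_comm p, key, mul_comm]

theorem IsTransform.transform_eq {P : Set (κ → ℝ)} {Q : RatFun κ}
    (h : IsTransform P Q) : transform P = Q := by
  have hex : ∃ Q, IsTransform P Q := ⟨Q, h⟩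
  rw [transform, dif_pos hex]
  exact hex.choose_spec.unique h

end Uniqueness

/-! ### Tangent cones and simplicial vertices -/

/-- The tangent cone at a point `v` of a convex set `P`: the union of all rays that start at `v`
and pass through points of `P` (as a cone with apex `v`). -/
def tangentCone {κ : Type} (P : Set (κ → ℝ)) (v : κ → ℝ) : Set (κ → ℝ) :=
  {x | ∃ t : ℝ, 0 ≤ t ∧ ∃ y ∈ P, x = v + t • (y - v)}

/-- The vertices of a convex set. -/
def vertices {κ : Type} (P : Set (κ → ℝ)) : Set (κ → ℝ) := P.extremePoints ℝ

/-- A vertex of `P` is simplicial if the tangent cone at it is a simplicial cone, that is,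
generated by linearly independent direction vectors. -/
def IsSimplicialVertex {κ : Type} (P : Set (κ → ℝ)) (v : κ → ℝ) : Prop :=
  v ∈ vertices P ∧
    ∃ (d : ℕ) (ε : Fin d → (κ → ℝ)), LinearIndependent ℝ ε ∧
      tangentCone P v = {x | ∃ c : Fin d → ℝ, (∀ i, 0 ≤ c i) ∧ x = v + ∑ i, c i • ε i}

/-! ### The Gelfand-Tsetlin polytope -/

/-- The positions `(i, j)` in a number triangle with `n` rows: rows and columns are numbered
from `0`, and row `i` consists of the positions with `0 ≤ j < n - i`. -/
abbrev Idx (n : ℕ) : Type := {k : Fin n × Fin n // (k.1 : ℕ) + (k.2 : ℕ) < n}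

/-- The position `(i, j)`. -/
def pos {n : ℕ} (i j : ℕ) (h : i + j < n) : Idx n :=
  ⟨(⟨i, by omega⟩, ⟨j, by omega⟩), h⟩

/-- The Gelfand-Tsetlin polytope of the weight `lam`. -/
def GTPolytope {n : ℕ} (lam : Fin n → ℤ) : Set (Idx n → ℝ) :=
  {A | (∀ j : Fin n, A (pos 0 j (by omega)) = (lam j : ℝ)) ∧
    ∀ (i j : ℕ) (h : i + 1 + j < n),
      A (pos (i + 1) j h) ≤ A (pos i j (by omega)) ∧
      A (pos i (j + 1) (by omega)) ≤ A (pos (i + 1) j h)}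

/-! ### The specialization of the variables -/

/-- The exponent of the Laurent monomial in `x` that is substituted for the variable `t (i, j)`:
with variables `x` numbered from `0`, it is `x 0` for `i = 0` and `(x (i - 1))⁻¹ * x i`
for `i > 0`. -/
def specExponent {n : ℕ} (k : Idx n) : Fin n → ℤ :=
  if (k.1.1 : ℕ) = 0 then Pi.single k.1.1 1
  else Pi.single k.1.1 1 - Pi.single ⟨(k.1.1 : ℕ) - 1, by omega⟩ 1

/-- The effect of the specialization on exponents of monomials. -/
def specHom (n : ℕ) : (Idx n → ℤ) →+ (Fin n → ℤ) where
  toFun a := ∑ k, a k • specExponent k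
  map_zero' := by simp
  map_add' a b := by simp [add_smul, Finset.sum_add_distrib]

/-- The specialization `F` on Laurent polynomials: the ring homomorphism that maps `t ^ a` to
`∏ k, (the monomial substituted for t k) ^ a k`. -/
def specLaurent (n : ℕ) : Laurent (Idx n) →+* Laurent (Fin n) :=
  AddMonoidAlgebra.mapDomainRingHom ℤ (specHom n)

/-- `R` is obtained from the rational function `Q` by the specialization: for some presentation
`Q = p / q` whose denominator does not specialize to zero, `R = F(p) / F(q)`. -/
def IsSpecialization {n : ℕ} (Q : RatFun (Idx n)) (R : RatFun (Fin n)) : Prop :=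
  ∃ q p : Laurent (Idx n), specLaurent n q ≠ 0 ∧ Q = toRat p / toRat q ∧
    R = toRat (specLaurent n p) / toRat (specLaurent n q)

open Classical in
/-- The specialization `F(Q)` of a rational function `Q`; it is meaningful only if
`∃ R, IsSpecialization Q R` (and then it is the only such `R`, see
`IsSpecialization.specRat_eq`). -/
def specRat {n : ℕ} (Q : RatFun (Idx n)) : RatFun (Fin n) :=
  if h : ∃ R, IsSpecialization Q R then h.choose else 0

theorem IsSpecialization.unique {n : ℕ} {Q : RatFun (Idx n)} {R R' : RatFun (Fin n)}
    (h : IsSpecialization Q R) (h' : IsSpecialization Q R') : R = R' := by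
  obtain ⟨q, p, hq, hQ, rfl⟩ := h
  obtain ⟨q', p', hq', hQ', rfl⟩ := h'
  have h0 : q ≠ 0 := fun h => hq (by rw [h, map_zero])
  have h0' : q' ≠ 0 := fun h => hq' (by rw [h, map_zero])
  rw [hQ, div_eq_div_iff (toRat_ne_zero h0) (toRat_ne_zero h0')] at hQ'
  simp only [toRat, ← map_mul] at hQ'
  have key : p * q' = p' * q := IsFractionRing.injective (Laurent (Idx n)) (RatFun (Idx n)) hQ'
  rw [div_eq_div_iff (toRat_ne_zero hq) (toRat_ne_zero hq')]
  simp only [toRat, ← map_mul]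
  rw [key]

theorem IsSpecialization.specRat_eq {n : ℕ} {Q : RatFun (Idx n)} {R : RatFun (Fin n)}
    (h : IsSpecialization Q R) : specRat Q = R := by
  have hex : ∃ R, IsSpecialization Q R := ⟨R, h⟩
  rw [specRat, dif_pos hex]
  exact hex.choose_spec.unique h

/-! ### The action of the symmetric group and the summands of Weyl's formula -/

/-- The action of a permutation `w` on Laurent polynomials by `x i ↦ x (w i)`; on exponents
it is `(w a) (w i) = a i`. -/
def permLaurent {n : ℕ} (w : Equiv.Perm (Fin n)) : Laurent (Fin n) ≃+* Laurent (Fin n) :=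
  AddMonoidAlgebra.mapDomainRingEquiv ℤ (AddEquiv.arrowCongr w (AddEquiv.refl ℤ))

/-- The action of a permutation `w` on rational functions by `x i ↦ x (w i)`. -/
def permRat {n : ℕ} (w : Equiv.Perm (Fin n)) : RatFun (Fin n) ≃+* RatFun (Fin n) :=
  IsFractionRing.ringEquivOfRingEquiv (permLaurent w)

/-- The expression `e ^ lam / ∏ i < j, (1 - x j / x i)`. -/
def weylTerm {n : ℕ} (lam : Fin n → ℤ) : RatFun (Fin n) :=
  toRat (monomial lam) / ∏ i : Fin n, ∏ j ∈ Finset.Ioi i, (1 - var j / var i)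

end GelfandTsetlin

end

/-!
The integer points of the Gelfand-Tsetlin polytope, and those of its tangent cones, are the number
triangles with top row `lam` in which every entry is bounded by one or both of the entries above it.
The specialized generating function is computed by summation over one entry after the other, from
the last row upwards. The sum over an entry of weight `a` (a monomial `x ^ a` substituted for its
variable) between the entries `k` and `k + 1` of the row above is a sum of two terms, one for each
end of the segment: the weight `a` is added to the weight of the entry at this end, and a geometric
series in `x ^ a` or its inverse appears as a factor (`HasValue.addCoordinate`); for a ray there
is only one of the terms. The weights that occur are never zero since they are lower triangular
(`IsLowerTriangular`), so that all specializations are defined. The sum over the rows up to `i`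
is encoded as a linear functional on formal combinations of systems of weights for row `i`
(`rowFunctional`), and `specRat_transform_eq_triangleValue` identifies the resulting rational
function with the specialization of the integer-point transform.

Brion's formula. The vertices of the polytope are the triangles in which every entry equals one of
the two entries above it (`mem_vertices_iff`), and the tangent cone at a vertex is given by the
inequalities that are tight there (`mem_tangentCone_iff`). A choice of one of the two terms for
every entry is a choice of a vertex, apart from entries with two equal neighbours above, where
both terms belong to the same tangent cone. Hence the value of the polytope is the sum of the
values of the tangent cones (`triangleValue_eq_sum`).

Vertices with two equal entries in a row. Such a vertex contributes zero (`vertexValue_eq_zero`).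
In the first row with two equal entries, the functional is invariant under the shifted
transposition `(u, v) ↦ (v - 1, u + 1)` of these two entries. In the next row there is an entry
squeezed between them, and its sum from `v` to `u` changes its sign under that transposition, as
`∑ x ^ k` over `v ≤ k ≤ u` becomes minus itself. The other factors change only by multiples of a
similar sum for a neighbouring squeezed entry, so the next functional equals its own negative up to
terms that are invariant under a shifted transposition in that row
(`IsTwistInvariant.rowStep_mem`). Thus all later functionals are combinations of invariant ones, and
the row with a single entry admits no transposition.

Vertices with strictly decreasing rows. Every row arises from the previous one by the deletion of
one entry, so these vertices correspond to the orders in which the entries of `lam` can be deleted,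
that is, to permutations (`exists_strict_triangle`, `IsVertexTriangle.exists_perm`); the tangent
cone has one inequality for each entry outside of the top row, and its value is a product of
geometric series, one for each pair of deleted entries. This product is the summand of Weyl's
formula (`vertexValue_eq_permRat_weylTerm`). These vertices are exactly the simplicial ones: if a
row has two equal entries, the tangent cone has four facets whose functionals satisfy
`φ 0 + φ 1 = φ 2 + φ 3`, which is impossible for a simplicial cone
(`hasStrictRows_of_isSimplicialVertex`).
-/

noncomputable section

namespace GelfandTsetlin

/-! ### Row functionals and the twisted transposition -/

section RowStep

variable {K A : Type} [Field K] [AddCommGroup A] (X : Multiplicative A →* K)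

/-- The sum `1 / (1 - X a)` of the geometric series with ratio `X a` (with value `0` if
`X a = 1`). -/
def geom (a : A) : K := (1 - X (.ofAdd a))⁻¹

theorem geom_neg (a : A) : geom X (-a) = -(X (.ofAdd a) * geom X a) := by
  have h : X (.ofAdd (-a)) * X (.ofAdd a) = 1 := by
    rw [← map_mul, ← ofAdd_add, neg_add_cancel, ofAdd_zero, map_one]
  have hx : X (.ofAdd a) ≠ 0 := right_ne_zero_of_mul_eq_one h
  rw [geom, geom, eq_inv_of_mul_eq_one_left h]
  by_cases h1 : X (.ofAdd a) = 1
  · simp [h1]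
  · have h2 : 1 - X (.ofAdd a) ≠ 0 := sub_ne_zero.2 (Ne.symm h1)
    have h3 : 1 - (X (.ofAdd a))⁻¹ ≠ 0 := sub_ne_zero.2 fun h => h1 (inv_eq_one.1 h.symm)
    have h4 : X (.ofAdd a) - 1 ≠ 0 := sub_ne_zero.2 h1
    field_simp
    ring

/-- The algebra of formal linear combinations of systems of weights for the entries of one row of
a triangle: the basis element `single b 1` assigns the weight `b k` to entry `k`. -/
abbrev RowAlg (K A : Type) [Field K] [AddCommGroup A] : Type := AddMonoidAlgebra K (ℕ → A)

/-- The contribution of an entry `k` of weight `a` to the row above it, after summation over all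
values of the entry which are at most the entry `k` above (if `p` holds) and at least the
entry `k + 1` above (if `q` holds). A sum over a segment is the sum of those over two rays. -/
def node (p q : Prop) (k : ℕ) (a : A) : RowAlg K A :=
  open Classical in
  (if p then .single (Pi.single k a) (geom X (-a)) else 0) +
    (if q then .single (Pi.single (k + 1) a) (geom X a) else 0)

/-- The linear functional on `RowAlg K A` with prescribed values on the basis. -/
def functional (F : (ℕ → A) → K) : RowAlg K A →ₗ[K] K :=
  Finsupp.linearCombination K F ∘ₗ (AddMonoidAlgebra.coeffLinearEquiv K).toLinearMap

theorem functional_single (F : (ℕ → A) → K) (b : ℕ → A) (c : K) :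
    functional F (.single b c) = c * F b := by
  simp [functional]

theorem functional_ext {N N' : RowAlg K A →ₗ[K] K}
    (h : ∀ b, N (.single b 1) = N' (.single b 1)) : N = N' := by
  ext b
  simpa using h b

/-- The passage to the next row, which has `m` entries: the functional `N` records a sum over the
rows above as a function of the weights of the last of them. The entries of that row get the
weights `c`, and the entry `k` of the next row is bounded by the entry `k` above it if `L k` holds,
and by the entry `k + 1` if `R k` holds. -/
def rowStep (m : ℕ) (L R : ℕ → Prop) (c : ℕ → A) (N : RowAlg K A →ₗ[K] K) :
    RowAlg K A →ₗ[K] K :=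
  functional fun a => N (.single c 1 * ∏ k ∈ Finset.range m, node X (L k) (R k) k (a k))

theorem rowStep_single (m : ℕ) (L R : ℕ → Prop) (c : ℕ → A) (N : RowAlg K A →ₗ[K] K)
    (a : ℕ → A) :
    rowStep X m L R c N (.single a 1) =
      N (.single c 1 * ∏ k ∈ Finset.range m, node X (L k) (R k) k (a k)) := by
  simp [rowStep, functional_single]

theorem Pi_single_comp_swap {ι : Type} [DecidableEq ι] (i j k : ι) (a : A) :
    (Pi.single k a : ι → A) ∘ Equiv.swap i j = Pi.single (Equiv.swap i j k) a := by
  funext l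
  simp only [Function.comp_apply, Pi.single_apply]
  congr 1
  rw [eq_iff_iff]
  exact Equiv.swap_apply_eq_iff

/-- The algebra automorphism that exchanges the entries `j` and `j + 1` of a row by the shifted
transposition `(u, v) ↦ (v - 1, u + 1)`. On monomials with weights `b` this multiplies by
`X (b (j + 1) - b j)` and exchanges two weights. -/
def twist (j : ℕ) : RowAlg K A →ₐ[K] RowAlg K A :=
  AddMonoidAlgebra.lift K (RowAlg K A) (ℕ → A)
    { toFun := fun b => .single (b.toAdd ∘ Equiv.swap j (j + 1))
        (X (.ofAdd (b.toAdd (j + 1) - b.toAdd j)))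
      map_one' := by simp [AddMonoidAlgebra.one_def, Pi.zero_comp]
      map_mul' := fun b b' => by
        rw [AddMonoidAlgebra.single_mul_single, ← map_mul, ← ofAdd_add]
        have e : (b * b').toAdd (j + 1) - (b * b').toAdd j =
            b.toAdd (j + 1) - b.toAdd j + (b'.toAdd (j + 1) - b'.toAdd j) := by
          simp only [toAdd_mul, Pi.add_apply]
          abel
        rw [e, toAdd_mul]
        rfl }

theorem twist_single (j : ℕ) (b : ℕ → A) (c : K) :
    twist X j (.single b c) =
      .single (b ∘ Equiv.swap j (j + 1)) (c * X (.ofAdd (b (j + 1) - b j))) := by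
  simp [twist, AddMonoidAlgebra.lift_single]

/-- Invariance of a functional under the shifted transposition of the entries `j` and `j + 1`. -/
def IsTwistInvariant (j : ℕ) (N : RowAlg K A →ₗ[K] K) : Prop :=
  ∀ b : ℕ → A, N (.single b 1) =
    X (.ofAdd (b (j + 1) - b j)) * N (.single (b ∘ Equiv.swap j (j + 1)) 1)

variable {X} in
theorem IsTwistInvariant.map_twist {j : ℕ} {N : RowAlg K A →ₗ[K] K} (h : IsTwistInvariant X j N)
    (p : RowAlg K A) : N (twist X j p) = N p := by
  have : N ∘ₗ (twist X j).toLinearMap = N := functional_ext fun b => by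
    have e : (AddMonoidAlgebra.single (b ∘ Equiv.swap j (j + 1))
        (1 * X (.ofAdd (b (j + 1) - b j))) : RowAlg K A) =
        X (.ofAdd (b (j + 1) - b j)) • .single (b ∘ Equiv.swap j (j + 1)) 1 := by
      simp
    rw [LinearMap.comp_apply, AlgHom.toLinearMap_apply, twist_single, e, map_smul, h b,
      smul_eq_mul]
  exact LinearMap.congr_fun this p

/-- A functional built from a part `Y` that does not distinguish the weights of the entries
`j` and `j + 1` and a part `Z` depending on these two weights only. -/
theorem isTwistInvariant_functional {j : ℕ} (N : RowAlg K A →ₗ[K] K)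
    (Y : (ℕ → A) → RowAlg K A) (Z : A → A → RowAlg K A)
    (hY : ∀ a, Y (a ∘ Equiv.swap j (j + 1)) = Y a)
    (hZ : ∀ a b, X (.ofAdd (b - a)) • Z b a = Z a b) :
    IsTwistInvariant X j (functional fun a => N (Y a * Z (a j) (a (j + 1)))) := by
  intro b
  simp only [functional_single, one_mul, hY, Function.comp_apply, Equiv.swap_apply_left,
    Equiv.swap_apply_right]
  rw [← hZ (b j) (b (j + 1)), mul_smul_comm, map_smul, smul_eq_mul]

theorem twist_node_self (j : ℕ) (a : A) :
    twist X j (node X True True j a) = -node X True True j a := by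
  simp only [node, if_true, map_add, twist_single, Pi_single_comp_swap, Equiv.swap_apply_left,
    Equiv.swap_apply_right]
  have h1 : (Pi.single j a : ℕ → A) (j + 1) = 0 := Pi.single_eq_of_ne (by omega) _
  have h2 : (Pi.single (j + 1) a : ℕ → A) j = 0 := Pi.single_eq_of_ne (by omega) _
  rw [h1, h2, Pi.single_eq_same, Pi.single_eq_same, zero_sub, sub_zero]
  have e := geom_neg X (-a)
  rw [neg_neg] at e
  rw [mul_comm, mul_comm (geom X a), ← neg_eq_iff_eq_neg.2 (geom_neg X a),
    ← neg_eq_iff_eq_neg.2 e, neg_add, add_comm]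
  congr 1 <;> ext <;> simp

/-- The change of the contribution of the entry `k` under the shifted transposition of the entries
`j` and `j + 1` of the row above. Only neighbours of the entry `j` contribute, and their change
is a multiple of the contribution of an entry lying between the entries `j` and `j + 1`. -/
def nodeChange (j : ℕ) (p q : Prop) (k : ℕ) (a : A) : RowAlg K A :=
  open Classical in
  if k + 1 = j ∧ q then X (.ofAdd (-a)) • node X True True j a
  else if k = j + 1 ∧ p then X (.ofAdd a) • node X True True j a else 0

theorem twist_node_of_ne {j k : ℕ} (hk : k ≠ j) (p q : Prop) (a : A) :
    twist X j (node X p q k a) = node X p q k a + nodeChange X j p q k a := by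
  have hx : X (.ofAdd a) * X (.ofAdd (-a)) = 1 := by
    rw [← map_mul, ← ofAdd_add, add_neg_cancel, ofAdd_zero, map_one]
  have hg := geom_neg X a
  have fixed : ∀ (l : ℕ) (c : K), l ≠ j → l ≠ j + 1 →
      twist X j (.single (Pi.single l a) c) = .single (Pi.single l a) c := by
    intro l c h1 h2
    rw [twist_single, Pi_single_comp_swap, Equiv.swap_apply_of_ne_of_ne h1 h2,
      Pi.single_eq_of_ne h1.symm, Pi.single_eq_of_ne h2.symm, sub_zero, ofAdd_zero, map_one,
      mul_one]
  have left : ∀ c : K, twist X j (.single (Pi.single j a) c) =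
      .single (Pi.single (j + 1) a) (c * X (.ofAdd (-a))) := by
    intro c
    rw [twist_single, Pi_single_comp_swap, Equiv.swap_apply_left, Pi.single_eq_same,
      Pi.single_eq_of_ne (by omega), zero_sub]
  have right : ∀ c : K, twist X j (.single (Pi.single (j + 1) a) c) =
      .single (Pi.single j a) (c * X (.ofAdd a)) := by
    intro c
    rw [twist_single, Pi_single_comp_swap, Equiv.swap_apply_right, Pi.single_eq_same,
      Pi.single_eq_of_ne (by omega), sub_zero]
  by_cases h1 : k + 1 = j
  · subst h1
    have h2 : k ≠ k + 1 + 1 := by omega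
    by_cases hp : p <;> by_cases hq : q <;>
      simp only [node, nodeChange, hp, hq, if_true, if_false, map_add, and_true,
        and_false, map_zero, fixed k _ hk h2, left, smul_add, add_zero, zero_add,
        AddMonoidAlgebra.smul_single, smul_eq_mul, h2]
    all_goals
      have : geom X a + X (.ofAdd (-a)) * geom X (-a) = 0 := by
        rw [hg]
        linear_combination -(geom X a) * hx
      have e : (.single (Pi.single (k + 1) a) (geom X a) : RowAlg K A) +
          .single (Pi.single (k + 1) a) (X (.ofAdd (-a)) * geom X (-a)) = 0 := by
        rw [← AddMonoidAlgebra.single_add, this, AddMonoidAlgebra.single_zero]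
      rw [mul_comm (geom X a)]
      linear_combination -e
  · by_cases h2 : k = j + 1
    · subst h2
      have h3 : j + 1 + 1 ≠ j := by omega
      have h4 : j + 1 + 1 ≠ j + 1 := by omega
      by_cases hp : p <;> by_cases hq : q <;>
        simp only [node, nodeChange, hp, hq, h1, if_true, if_false, map_add, and_true,
          and_false, map_zero, fixed _ _ h3 h4, right, smul_add, add_zero, zero_add,
          AddMonoidAlgebra.smul_single, smul_eq_mul]
      all_goals
        have : geom X (-a) + X (.ofAdd a) * geom X a = 0 := by rw [hg]; ring
        have e : (.single (Pi.single (j + 1) a) (geom X (-a)) : RowAlg K A) +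
            .single (Pi.single (j + 1) a) (X (.ofAdd a) * geom X a) = 0 := by
          rw [← AddMonoidAlgebra.single_add, this, AddMonoidAlgebra.single_zero]
        rw [mul_comm (geom X (-a))]
      · linear_combination -e
      · linear_combination -e
    · have h3 : k + 1 ≠ j + 1 := by omega
      simp only [node, nodeChange, h1, h2, false_and, if_false, add_zero, map_add]
      congr 1 <;> split_ifs <;> first | exact map_zero _ | exact fixed _ _ ‹_› ‹_›

/-- The functionals spanned by those that are invariant under the shifted transposition of a pair
of neighbouring entries `j`, `j + 1` with `T j`, in a row with `m` entries. -/
def invariantSpan (m : ℕ) (T : ℕ → Prop) : Submodule K (RowAlg K A →ₗ[K] K) :=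
  Submodule.span K {N | ∃ j, j + 1 < m ∧ T j ∧ IsTwistInvariant X j N}

theorem invariantSpan_of_le_one {m : ℕ} (hm : m ≤ 1) (T : ℕ → Prop) :
    invariantSpan X m T = ⊥ := by
  rw [invariantSpan, Submodule.span_eq_bot]
  rintro N ⟨j, hj, -⟩
  omega

theorem rowStep_add (m : ℕ) (L R : ℕ → Prop) (c : ℕ → A) (N N' : RowAlg K A →ₗ[K] K) :
    rowStep X m L R c (N + N') = rowStep X m L R c N + rowStep X m L R c N' :=
  functional_ext fun a => by simp [rowStep_single]

theorem rowStep_smul (m : ℕ) (L R : ℕ → Prop) (c : ℕ → A) (x : K) (N : RowAlg K A →ₗ[K] K) :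
    rowStep X m L R c (x • N) = x • rowStep X m L R c N :=
  functional_ext fun a => by simp [rowStep_single]

theorem rowStep_zero (m : ℕ) (L R : ℕ → Prop) (c : ℕ → A) :
    rowStep X m L R c (0 : RowAlg K A →ₗ[K] K) = 0 :=
  functional_ext fun a => by simp [rowStep_single]

theorem twist_single_of_eq {j : ℕ} {c : ℕ → A} (hc : c j = c (j + 1)) (x : K) :
    twist X j (.single c x) = .single c x := by
  rw [twist_single, hc, sub_self, ofAdd_zero, map_one, mul_one]
  congr 1
  funext k
  rcases eq_or_ne k j with rfl | h1
  · simp [hc]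
  rcases eq_or_ne k (j + 1) with rfl | h2
  · simp [hc]
  · simp [Equiv.swap_apply_of_ne_of_ne h1 h2]

/-- A product over entries other than `j` and `j + 1` does not distinguish the weights of these
two. -/
theorem prod_comp_swap {B C : Type} [CommMonoid B] {j : ℕ} {s : Finset ℕ} (h1 : j ∉ s)
    (h2 : j + 1 ∉ s) (f : ℕ → C → B) (a : ℕ → C) :
    ∏ k ∈ s, f k ((a ∘ Equiv.swap j (j + 1)) k) = ∏ k ∈ s, f k (a k) := by
  refine Finset.prod_congr rfl fun k hk => ?_
  rw [Function.comp_apply, Equiv.swap_apply_of_ne_of_ne] <;> rintro rfl <;> contradiction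

/-- Invariance under the shifted transposition of two entries of a row is inherited by the next
row, provided that there is an entry squeezed between the two: the functional changes its sign up
to terms in which a neighbouring entry of the next row is squeezed as well, and such terms are
invariant under the shifted transposition of two entries of that row. -/
theorem IsTwistInvariant.rowStep_mem {m j : ℕ} {L R : ℕ → Prop} {c : ℕ → A}
    {N : RowAlg K A →ₗ[K] K} (h2 : (2 : K) ≠ 0) (hN : IsTwistInvariant X j N) (hj : j < m)
    (hL : L j) (hR : R j) (hc : c j = c (j + 1)) :
    rowStep X m L R c N ∈ invariantSpan X m fun j => R j ∧ L (j + 1) := by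
  set s := (Finset.range m).erase j with hs
  set D : A → RowAlg K A := node X True True j with hD
  -- The term in which exactly the entries of `t` change under the transposition.
  set G : Finset ℕ → (RowAlg K A →ₗ[K] K) := fun t => functional fun a =>
    N (.single c 1 * D (a j) * ((∏ k ∈ t, nodeChange X j (L k) (R k) k (a k)) *
      ∏ k ∈ s \ t, node X (L k) (R k) k (a k))) with hG
  have hOj : ∀ a, node X (L j) (R j) j a = D a := fun a => by
    rw [hD, eq_true hL, eq_true hR]
  have hsplit : ∀ a : ℕ → A, ∏ k ∈ Finset.range m, node X (L k) (R k) k (a k) =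
      D (a j) * ∏ k ∈ s, node X (L k) (R k) k (a k) := fun a => by
    rw [← Finset.mul_prod_erase _ _ (Finset.mem_range.2 hj), hOj]
  have hG0 : rowStep X m L R c N = G ∅ := functional_ext fun a => by
    simp only [rowStep_single, hG, functional_single, one_mul, Finset.prod_empty, hsplit,
      Finset.sdiff_empty, mul_assoc]
  have hsum : rowStep X m L R c N = -∑ t ∈ s.powerset, G t := functional_ext fun a => by
    have e : ∀ k ∈ s, twist X j (node X (L k) (R k) k (a k)) =
        nodeChange X j (L k) (R k) k (a k) + node X (L k) (R k) k (a k) := fun k hk => by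
      rw [twist_node_of_ne X (Finset.ne_of_mem_erase hk), add_comm]
    rw [rowStep_single, ← hN.map_twist, map_mul (twist X j), hsplit, map_mul (twist X j), map_prod,
      Finset.prod_congr rfl e, Finset.prod_add, hD, twist_node_self, twist_single_of_eq X hc,
      neg_mul, mul_neg, map_neg, ← mul_assoc, Finset.mul_sum, map_sum, LinearMap.neg_apply,
      LinearMap.sum_apply]
    simp only [hG, functional_single, one_mul, hD]
  have hmem : ∀ t ∈ s.powerset.erase ∅, G t ∈ invariantSpan X m fun j => R j ∧ L (j + 1) := by
    intro t ht
    obtain ⟨hne, hts⟩ := Finset.mem_erase.1 ht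
    replace hts := Finset.mem_powerset.1 hts
    obtain ⟨k, hk⟩ := Finset.nonempty_iff_ne_empty.2 hne
    have hkj : k ≠ j := Finset.ne_of_mem_erase (hts hk)
    have hkm : k < m := Finset.mem_range.1 (Finset.mem_of_mem_erase (hts hk))
    have hjt : j ∉ t := fun h => Finset.notMem_erase _ _ (hts h)
    have hjs : j ∉ s \ t := fun h => Finset.notMem_erase _ _ (Finset.mem_sdiff.1 h).1
    have hks : k ∉ s \ t := fun h => (Finset.mem_sdiff.1 h).2 hk
    by_cases hA : k + 1 = j ∧ R k
    · refine Submodule.subset_span ⟨k, by omega, ⟨hA.2, by rwa [hA.1]⟩, ?_⟩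
      have hj1 := hA.1
      convert isTwistInvariant_functional X (j := k) N
        (fun a => .single c 1 * ((∏ l ∈ t.erase k, nodeChange X j (L l) (R l) l (a l)) *
          ∏ l ∈ s \ t, node X (L l) (R l) l (a l)))
        (fun a b => (X (.ofAdd (-a)) • D a) * D b) ?_ ?_ using 2
      · funext a
        congr 1
        rw [← Finset.mul_prod_erase t _ hk]
        simp only [nodeChange, hA, and_self, if_true, ← hD]
        ring
      · intro a
        rw [prod_comp_swap (by simp) (by rw [hj1]; exact fun h => hjt (Finset.mem_of_mem_erase h))
            (fun l x => nodeChange X j (L l) (R l) l x),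
          prod_comp_swap hks (by rwa [hj1]) (fun l x => node X (L l) (R l) l x)]
      · intro a b
        simp only [smul_mul_assoc, smul_smul, ← map_mul, ← ofAdd_add]
        rw [mul_comm (D b)]
        congr 4
        abel
    · by_cases hB : k = j + 1 ∧ L k
      · refine Submodule.subset_span ⟨j, by omega, ⟨hR, hB.1 ▸ hB.2⟩, ?_⟩
        have hj1 := hB.1
        convert isTwistInvariant_functional X (j := j) N
          (fun a => .single c 1 * ((∏ l ∈ t.erase k, nodeChange X j (L l) (R l) l (a l)) *
            ∏ l ∈ s \ t, node X (L l) (R l) l (a l)))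
          (fun a b => D a * (X (.ofAdd b) • D b)) ?_ ?_ using 2
        · funext a
          congr 1
          rw [← Finset.mul_prod_erase t _ hk]
          rw [nodeChange, if_neg hA, if_pos hB, ← hj1]
          ring
        · intro a
          rw [prod_comp_swap (fun h => hjt (Finset.mem_of_mem_erase h)) (by rw [← hj1]; simp)
              (fun l x => nodeChange X j (L l) (R l) l x),
            prod_comp_swap hjs (by rwa [← hj1]) (fun l x => node X (L l) (R l) l x)]
        · intro a b
          simp only [mul_smul_comm, smul_smul, ← map_mul, ← ofAdd_add]
          rw [mul_comm (D b)]
          congr 4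
          abel
      · have : G t = 0 := functional_ext fun a => by
          simp only [hG, functional_single]
          rw [Finset.prod_eq_zero hk (by simp [nodeChange, hA, hB])]
          simp
        rw [this]
        exact zero_mem _
  have h3 : (2 : K) • rowStep X m L R c N = -∑ t ∈ s.powerset.erase ∅, G t := by
    have := Finset.add_sum_erase s.powerset G (Finset.empty_mem_powerset s)
    rw [two_smul]
    nth_rw 1 [hsum]
    rw [← this, hG0]
    abel
  rw [← inv_smul_smul₀ h2 (rowStep X m L R c N), h3]
  exact Submodule.smul_mem _ _ (neg_mem (sum_mem hmem))

theorem rowStep_mem_invariantSpan {m : ℕ} {L R T : ℕ → Prop} {c : ℕ → A}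
    {N : RowAlg K A →ₗ[K] K} (h2 : (2 : K) ≠ 0) (hT : ∀ j < m, T j → L j ∧ R j)
    (hc : ∀ j < m, c j = c (j + 1)) (hN : N ∈ invariantSpan X (m + 1) T) :
    rowStep X m L R c N ∈ invariantSpan X m fun j => R j ∧ L (j + 1) := by
  induction hN using Submodule.span_induction with
  | mem N hN =>
    obtain ⟨j, hj, hTj, hN⟩ := hN
    have hj' : j < m := by omega
    exact hN.rowStep_mem X h2 hj' (hT j hj' hTj).1 (hT j hj' hTj).2 (hc j hj')
  | zero => rw [rowStep_zero]; exact zero_mem _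
  | add N N' _ _ h h' => rw [rowStep_add]; exact add_mem h h'
  | smul x N _ h => rw [rowStep_smul]; exact Submodule.smul_mem _ _ h

/-- If two neighbouring entries are bounded from below and from above, respectively, by the entry
above both of them, and by nothing else, then the functional of their row is invariant under their
shifted transposition. -/
theorem isTwistInvariant_rowStep {m j : ℕ} {L R : ℕ → Prop} (c : ℕ → A)
    (N : RowAlg K A →ₗ[K] K) (hj : j + 1 < m) (hR : R j) (hL : L (j + 1)) (hL' : ¬ L j)
    (hR' : ¬ R (j + 1)) : IsTwistInvariant X j (rowStep X m L R c N) := by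
  set s := ((Finset.range m).erase j).erase (j + 1)
  convert isTwistInvariant_functional X (j := j) N
    (fun a => .single c 1 * ∏ l ∈ s, node X (L l) (R l) l (a l))
    (fun a b => .single (Pi.single (j + 1) a) (geom X a) *
      .single (Pi.single (j + 1) b) (geom X (-b))) ?_ ?_ using 2
  · unfold rowStep
    congr 1
    funext a
    congr 1
    rw [← Finset.mul_prod_erase _ _ (Finset.mem_range.2 (show j < m by omega)),
      ← Finset.mul_prod_erase _ _
        (Finset.mem_erase.2 ⟨show j + 1 ≠ j by omega, Finset.mem_range.2 hj⟩)]
    have e1 : ∀ x, node X (L j) (R j) j x = .single (Pi.single (j + 1) x) (geom X x) := by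
      simp [node, hR, hL']
    have e2 : ∀ x, node X (L (j + 1)) (R (j + 1)) (j + 1) x =
        .single (Pi.single (j + 1) x) (geom X (-x)) := by
      simp [node, hR', hL]
    rw [e1, e2]
    ring
  · intro a
    rw [prod_comp_swap (by simp [s]) (by simp [s]) (fun l x => node X (L l) (R l) l x)]
  · intro a b
    have h1 := geom_neg X a
    have h2 := geom_neg X (-b)
    have h3 : X (.ofAdd (b - a)) * X (.ofAdd a) * X (.ofAdd (-b)) = 1 := by
      rw [← map_mul, ← map_mul, ← ofAdd_add, ← ofAdd_add]
      simp
    rw [neg_neg] at h2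
    rw [AddMonoidAlgebra.single_mul_single, AddMonoidAlgebra.single_mul_single,
      AddMonoidAlgebra.smul_single, smul_eq_mul, h1, h2, add_comm]
    congr 1
    linear_combination geom X (-b) * geom X a * h3

end RowStep

/-! ### Specialized values of formal Laurent series -/

section Values

variable {κ ι : Type}

/-- The exponential `x ^ a` as a rational function, as a multiplicative map. -/
def expo (ι : Type) : Multiplicative (ι → ℤ) →* RatFun ι where
  toFun a := toRat (monomial a.toAdd)
  map_one' := map_one (algebraMap (Laurent ι) (RatFun ι))
  map_mul' a b := by
    rw [← map_mul]
    congr 1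
    simp [monomial, AddMonoidAlgebra.single_mul_single]

theorem expo_ofAdd (a : ι → ℤ) : expo ι (.ofAdd a) = toRat (monomial a) := rfl

theorem one_sub_monomial_ne_zero {a : ι → ℤ} (ha : a ≠ 0) : (1 - monomial a : Laurent ι) ≠ 0 := by
  rw [sub_ne_zero, monomial, AddMonoidAlgebra.one_def, Ne,
    AddMonoidAlgebra.single_left_inj one_ne_zero]
  exact ha.symm

theorem mulSeries_one_sub_monomial (e : κ → ℤ) (f : (κ → ℤ) → ℤ) :
    mulSeries (1 - monomial e) f = fun a => f a - f (a - e) := by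
  have : (1 - monomial e : Laurent κ) = .single 0 1 + .single e (-1) := by
    rw [sub_eq_add_neg, monomial, ← AddMonoidAlgebra.single_neg, AddMonoidAlgebra.one_def]
  rw [this, mulSeries_add, mulSeries_single, mulSeries_single]
  funext a
  simp [sub_eq_add_neg]

theorem mulSeries_mapDomainRingEquiv (σ : (κ → ℤ) ≃+ (κ → ℤ)) (q : Laurent κ)
    (f : (κ → ℤ) → ℤ) :
    mulSeries (AddMonoidAlgebra.mapDomainRingEquiv ℤ σ q) (f ∘ σ.symm) =
      mulSeries q f ∘ σ.symm := by
  induction q using AddMonoidAlgebra.induction_linear with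
  | zero => rw [map_zero, mulSeries_zero, mulSeries_zero]; rfl
  | add q r hq hr => rw [map_add, mulSeries_add, hq, hr, mulSeries_add]; rfl
  | single b c =>
    rw [AddMonoidAlgebra.mapDomainRingEquiv_single, mulSeries_single, mulSeries_single]
    funext a
    simp

/-- The linear change of coordinates that adds the coordinate `p` to the coordinate `k`. -/
def shear [DecidableEq κ] {p k : κ} (h : p ≠ k) : (κ → ℤ) ≃+ (κ → ℤ) where
  toFun y := y + Pi.single k (y p)
  invFun y := y - Pi.single k (y p)
  left_inv y := by simp [Pi.single_eq_of_ne h]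
  right_inv y := by simp [Pi.single_eq_of_ne h]
  map_add' y z := by
    rw [Pi.add_apply, Pi.single_add]
    abel

theorem shear_symm_apply [DecidableEq κ] {p k : κ} (h : p ≠ k) (y : κ → ℤ) :
    (shear h).symm y = y - Pi.single k (y p) := rfl

variable [Fintype κ]

/-- The exponent of the monomial that arises from `t ^ a` by the substitution of `x ^ ω k` for the
variable `t k`. -/
def weightHom (ω : κ → ι → ℤ) : (κ → ℤ) →+ (ι → ℤ) where
  toFun a := ∑ k, a k • ω k
  map_zero' := by simp
  map_add' a b := by simp [add_smul, Finset.sum_add_distrib]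

/-- The substitution of `x ^ ω k` for `t k` on Laurent polynomials. -/
def weightSpec (ω : κ → ι → ℤ) : Laurent κ →+* Laurent ι :=
  AddMonoidAlgebra.mapDomainRingHom ℤ (weightHom ω)

/-- The formal Laurent series `f` is a rational function that the substitution of `x ^ ω k` for
`t k` takes to `Q`. -/
def HasValue (ω : κ → ι → ℤ) (f : (κ → ℤ) → ℤ) (Q : RatFun ι) : Prop :=
  ∃ q p : Laurent κ, weightSpec ω q ≠ 0 ∧ (mulSeries q f = fun a => p.coeff a) ∧
    Q = toRat (weightSpec ω p) / toRat (weightSpec ω q)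

theorem weightSpec_monomial (ω : κ → ι → ℤ) (a : κ → ℤ) :
    weightSpec ω (monomial a) = monomial (weightHom ω a) := by
  simp [weightSpec, monomial]

theorem HasValue.add {ω : κ → ι → ℤ} {f g : (κ → ℤ) → ℤ} {Q Q' : RatFun ι}
    (hf : HasValue ω f Q) (hg : HasValue ω g Q') : HasValue ω (f + g) (Q + Q') := by
  obtain ⟨q, p, hq, h, rfl⟩ := hf
  obtain ⟨q', p', hq', h', rfl⟩ := hg
  refine ⟨q * q', q' * p + q * p', ?_, ?_, ?_⟩
  · rw [map_mul]
    exact mul_ne_zero hq hq'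
  · rw [mulSeries_add_right, mulSeries_mul q q' g, h', mul_comm q q', mulSeries_mul, h,
      mulSeries_coeff, mulSeries_coeff]
    rfl
  · rw [div_add_div _ _ (toRat_ne_zero hq) (toRat_ne_zero hq')]
    simp only [toRat, ← map_mul, ← map_add]
    rw [mul_comm p]

theorem HasValue.sub {ω : κ → ι → ℤ} {f g : (κ → ℤ) → ℤ} {Q : RatFun ι}
    (hf : HasValue ω f Q) (hg : HasValue ω g 0) : HasValue ω (f - g) Q := by
  have hg' : HasValue ω (-g) 0 := by
    obtain ⟨q, p, hq, h, h0⟩ := hg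
    refine ⟨q, -p, hq, ?_, by simp [neg_div, ← h0]⟩
    have := mulSeries_add_right q g (-g)
    rw [add_neg_cancel, mulSeries_zero_right, h] at this
    rw [eq_neg_of_add_eq_zero_right this.symm]
    funext a
    simp
  simpa [sub_eq_add_neg] using hf.add hg'

/-- A series that is invariant under a translation has the value zero. -/
theorem hasValue_zero_of_periodic {ω : κ → ι → ℤ} {f : (κ → ℤ) → ℤ} {e : κ → ℤ}
    (he : weightHom ω e ≠ 0) (hf : ∀ a, f (a - e) = f a) : HasValue ω f 0 := by
  refine ⟨1 - monomial e, 0, ?_, ?_, by simp⟩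
  · rw [map_sub, map_one, weightSpec_monomial]
    exact one_sub_monomial_ne_zero he
  · rw [mulSeries_one_sub_monomial]
    funext a
    simp [hf]

variable [DecidableEq κ]

theorem weightSpec_shear (ω : κ → ι → ℤ) {p k : κ} (h : p ≠ k) (q : Laurent κ) :
    weightSpec ω (AddMonoidAlgebra.mapDomainRingEquiv ℤ (shear h) q) =
      weightSpec (ω + Pi.single p (ω k)) q := by
  induction q using AddMonoidAlgebra.induction_linear with
  | zero => simp
  | add q r hq hr => rw [map_add, map_add, hq, hr, map_add]
  | single b c =>
    rw [AddMonoidAlgebra.mapDomainRingEquiv_single]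
    simp only [weightSpec, AddMonoidAlgebra.mapDomainRingHom_apply,
      AddMonoidAlgebra.mapDomain_single]
    congr 1
    simp [weightHom, shear, smul_add, add_mul, Finset.sum_add_distrib, Pi.single_apply]

/-- Summation over a ray: if the series `g` extends `f` along the rays with direction `e` that
start at the hyperplane where the coordinates `p` and `k` coincide, then its value is that of `f`
with the weight of `k` added to that of `p`, times the sum of a geometric series. -/
theorem HasValue.ray {ω : κ → ι → ℤ} {f g : (κ → ℤ) → ℤ} {Q : RatFun ι} {p k : κ} (h : p ≠ k)
    (hf : HasValue (ω + Pi.single p (ω k)) f Q) {e : κ → ℤ} (he : weightHom ω e ≠ 0)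
    (hg : ∀ a, g a - g (a - e) = f (a - Pi.single k (a p))) :
    HasValue ω g (geom (expo ι) (weightHom ω e) * Q) := by
  obtain ⟨q, r, hq, hm, rfl⟩ := hf
  have h1 := one_sub_monomial_ne_zero he
  refine ⟨AddMonoidAlgebra.mapDomainRingEquiv ℤ (shear h) q * (1 - monomial e),
    AddMonoidAlgebra.mapDomainRingEquiv ℤ (shear h) r, ?_, ?_, ?_⟩
  · rw [map_mul, weightSpec_shear, map_sub, map_one, weightSpec_monomial]
    exact mul_ne_zero hq h1
  · have e1 : (fun a => g a - g (a - e)) = f ∘ (shear h).symm := by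
      funext a
      rw [hg, Function.comp_apply, shear_symm_apply]
    rw [mulSeries_mul, mulSeries_one_sub_monomial, e1, mulSeries_mapDomainRingEquiv, hm]
    funext a
    simp
  · rw [map_mul, weightSpec_shear, weightSpec_shear, map_sub, map_one, weightSpec_monomial, geom,
      expo_ofAdd]
    have h2 : (1 - toRat (monomial (weightHom ω e))) = toRat (1 - monomial (weightHom ω e)) := by
      simp [toRat]
    rw [h2, toRat, toRat, toRat, toRat, map_mul, div_mul_eq_div_div, inv_mul_eq_div]

theorem weightHom_single (ω : κ → ι → ℤ) (k : κ) (c : ℤ) :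
    weightHom ω (Pi.single k c) = c • ω k := by
  simp [weightHom, Pi.single_apply]

open Classical in
/-- Adding one coordinate `k` to a series in the other coordinates: the new coordinate is at most
the coordinate `a` (if `p` holds) and at least the coordinate `b` (if `q` holds). -/
theorem HasValue.addCoordinate {ω : κ → ι → ℤ} {f : (κ → ℤ) → ℤ} {Qa Qb : RatFun ι} {a b k : κ}
    {p q : Prop} (ha : a ≠ k) (hb : b ≠ k) (hω : ω k ≠ 0) (hf : ∀ y, f y ≠ 0 → y k = 0)
    (hpq : p ∨ q) (hab : p → q → ∀ y, f y ≠ 0 → y b ≤ y a)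
    (hfa : HasValue (ω + Pi.single a (ω k)) f Qa) (hfb : HasValue (ω + Pi.single b (ω k)) f Qb) :
    HasValue ω
      (fun y => if (p → y k ≤ y a) ∧ (q → y b ≤ y k) then f (Function.update y k 0) else 0)
      ((if p then geom (expo ι) (-ω k) * Qa else 0) +
        (if q then geom (expo ι) (ω k) * Qb else 0)) := by
  have hsub : ∀ (y : κ → ℤ) (c : ℤ),
      Function.update (y - Pi.single k c) k 0 = Function.update y k 0 := by
    intro y c
    funext l
    rcases eq_or_ne l k with rfl | hl
    · simp
    · simp [hl]
  have hshear : ∀ (y : κ → ℤ) (c : κ), c ≠ k → f (y - Pi.single k (y c)) =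
      if y k = y c then f (Function.update y k 0) else 0 := by
    intro y c hc
    split_ifs with h
    · congr 1
      funext l
      rcases eq_or_ne l k with rfl | hl
      · simp [h]
      · simp [hl]
    · by_contra h'
      have := hf _ h'
      simp at this
      omega
  have up : HasValue ω (fun y => if y k ≤ y a then f (Function.update y k 0) else 0)
      (geom (expo ι) (-ω k) * Qa) := by
    have e1 : weightHom ω (Pi.single k (-1)) = -ω k := by simp [weightHom_single]
    rw [← e1]
    refine hfa.ray ha (by rw [e1]; exact neg_ne_zero.2 hω) fun y => ?_
    simp only [hsub, hshear y a ha]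
    simp only [Pi.sub_apply, Pi.single_eq_same, Pi.single_eq_of_ne ha]
    split_ifs <;> omega
  have down : HasValue ω (fun y => if y b ≤ y k then f (Function.update y k 0) else 0)
      (geom (expo ι) (ω k) * Qb) := by
    have e1 : weightHom ω (Pi.single k 1) = ω k := by simp [weightHom_single]
    have := hfb.ray (g := fun y => if y b ≤ y k then f (Function.update y k 0) else 0) hb
      (e := Pi.single k 1) (by rwa [e1]) fun y => ?_
    · rwa [e1] at this
    simp only [hsub, hshear y b hb]
    simp only [Pi.sub_apply, Pi.single_eq_same, Pi.single_eq_of_ne hb]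
    split_ifs <;> omega
  have line : HasValue ω (fun y => f (Function.update y k 0)) 0 :=
    hasValue_zero_of_periodic (e := Pi.single k 1) (by simpa [weightHom_single] using hω)
      fun y => by rw [hsub]
  by_cases hp : p <;> by_cases hq : q
  · simp only [hp, hq, if_true, true_imp_iff]
    -- A segment is the union of two rays that cover a line and meet in the segment.
    convert (up.add down).sub line using 1
    funext y
    simp only [Pi.sub_apply, Pi.add_apply]
    by_cases h0 : f (Function.update y k 0) = 0
    · simp [h0]
    · have := hab hp hq _ h0
      rw [Function.update_of_ne ha, Function.update_of_ne hb] at this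
      split_ifs <;> omega
  · simpa [hp, hq] using up
  · simpa [hp, hq] using down
  · simp [hp, hq] at hpq

end Values

/-! ### Summation over a triangle, row by row -/

section Triangle

theorem pos_inj {n i j i' j' : ℕ} {h : i + j < n} {h' : i' + j' < n} :
    pos i j h = pos i' j' h' ↔ i = i' ∧ j = j' := by
  simp [pos]

theorem Idx.induction {n : ℕ} {P : Idx n → Prop} (h : ∀ i j h, P (pos i j h)) (k : Idx n) : P k :=
  h k.1.1 k.1.2 k.2

/-- The exponent of the monomial which is substituted for the variables of row `r`. -/
def rowExp (n r : ℕ) : Fin n → ℤ :=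
  fun s => (if (s : ℕ) = r then 1 else 0) - (if (s : ℕ) + 1 = r then 1 else 0)

theorem specExponent_pos {n i j : ℕ} (h : i + j < n) :
    specExponent (pos i j h) = rowExp n i := by
  funext s
  rcases i with _ | i
  · simp [specExponent, rowExp, pos, Pi.single_apply, Fin.ext_iff]
  · simp [specExponent, rowExp, pos, Pi.single_apply, Fin.ext_iff]

/-- The weights of the entries of row `i` (and `0` outside of the triangle). -/
def rowWeights {n : ℕ} (ω : Idx n → Fin n → ℤ) (i : ℕ) : ℕ → Fin n → ℤ :=
  fun k => if h : i + k < n then ω (pos i k h) else 0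

/-- The weights of the entries of row `i` under the specialization of the variables. -/
def rowConst (n i : ℕ) : ℕ → Fin n → ℤ :=
  fun k => if i + k < n then rowExp n i else 0

/-- The value, as a functional of the weights of row `i`, of the sum over the rows up to `i` of
all triangles with top row `top` where the entry `(i + 1, j)` is at most the entry `(i, j)` if
`L i j` holds, and at least the entry `(i, j + 1)` if `R i j` holds. The entries above row `i`
have the weights given by the specialization. -/
def rowFunctional (n : ℕ) (top : ℕ → ℤ) (L R : ℕ → ℕ → Prop) :
    ℕ → (RowAlg (RatFun (Fin n)) (Fin n → ℤ) →ₗ[RatFun (Fin n)] RatFun (Fin n))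
  | 0 => functional fun a => expo (Fin n) (.ofAdd (∑ k ∈ Finset.range n, top k • a k))
  | i + 1 => rowStep (expo (Fin n)) (n - (i + 1)) (L i) (R i) (rowConst n i)
      (rowFunctional n top L R i)

theorem rowFunctional_succ (n : ℕ) (top : ℕ → ℤ) (L R : ℕ → ℕ → Prop) (i : ℕ) :
    rowFunctional n top L R (i + 1) = rowStep (expo (Fin n)) (n - (i + 1)) (L i) (R i)
      (rowConst n i) (rowFunctional n top L R i) := rfl

/-- The triangles described in `rowFunctional` where only row `0`, the rows up to `i` and the first
`m` entries of row `i + 1` are taken into account and all other entries vanish. -/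
def IsPartialTriangle {n : ℕ} (top : ℕ → ℤ) (L R : ℕ → ℕ → Prop) (i m : ℕ)
    (y : Idx n → ℤ) : Prop :=
  (∀ j h, y (pos 0 j h) = top j) ∧
  (∀ r k (h : r + 1 + k < n), (r < i ∨ r = i ∧ k < m) →
    (L r k → y (pos (r + 1) k h) ≤ y (pos r k (by omega))) ∧
    (R r k → y (pos r (k + 1) (by omega)) ≤ y (pos (r + 1) k h))) ∧
  ∀ r k h, ¬ (r ≤ i ∨ r = i + 1 ∧ k < m) → y (pos r k h) = 0

theorem isPartialTriangle_zero_iff {n : ℕ} (top : ℕ → ℤ) (L R : ℕ → ℕ → Prop)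
    (y : Idx n → ℤ) : IsPartialTriangle top L R 0 0 y ↔
      y = ∑ j : Fin n, Pi.single (pos 0 j (by omega)) (top j) := by
  have key : ∀ r k h, (∑ j : Fin n, Pi.single (pos 0 j (by omega)) (top j) : Idx n → ℤ)
      (pos r k h) = if r = 0 then top k else 0 := by
    intro r k h
    rw [Finset.sum_apply]
    split_ifs with hr
    · subst hr
      rw [Finset.sum_eq_single (⟨k, by omega⟩ : Fin n)]
      · simp
      · intro j _ hj
        refine Pi.single_eq_of_ne (fun h' => hj ?_) _
        exact Fin.ext (pos_inj.1 h').2.symm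
      · simp
    · exact Finset.sum_eq_zero fun j _ =>
        Pi.single_eq_of_ne (fun h' => hr (pos_inj.1 h').1) _
  constructor
  · rintro ⟨h1, -, h3⟩
    funext q
    induction q using Idx.induction with
    | h r k h =>
      rw [key]
      split_ifs with hr
      · subst hr
        exact h1 k h
      · exact h3 r k h (by omega)
  · rintro rfl
    refine ⟨fun j h => by rw [key, if_pos rfl], fun r k h h' => by omega, fun r k h h' => ?_⟩
    rw [key, if_neg (by omega)]

theorem isPartialTriangle_succ_iff {n : ℕ} {top : ℕ → ℤ} {L R : ℕ → ℕ → Prop} {i m : ℕ}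
    (hm : i + 1 + m < n) (y : Idx n → ℤ) :
    IsPartialTriangle top L R i (m + 1) y ↔
      ((L i m → y (pos (i + 1) m hm) ≤ y (pos i m (by omega))) ∧
        (R i m → y (pos i (m + 1) (by omega)) ≤ y (pos (i + 1) m hm))) ∧
      IsPartialTriangle top L R i m (Function.update y (pos (i + 1) m hm) 0) := by
  have ne : ∀ {r k : ℕ} (h : r + k < n), ¬ (r = i + 1 ∧ k = m) →
      Function.update y (pos (i + 1) m hm) 0 (pos r k h) = y (pos r k h) := fun h h' =>
    Function.update_of_ne (fun e => h' (pos_inj.1 e)) _ _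
  constructor
  · rintro ⟨h1, h2, h3⟩
    refine ⟨h2 i m hm (by omega), fun j h => ?_, fun r k h hr => ?_, fun r k h hr => ?_⟩
    · rw [ne _ (by omega), h1]
    · rw [ne _ (by omega), ne _ (by omega), ne _ (by omega)]
      exact h2 r k h (by omega)
    · by_cases hk : r = i + 1 ∧ k = m
      · obtain ⟨rfl, rfl⟩ := hk
        simp
      · rw [ne _ hk]
        exact h3 r k h (by omega)
  · rintro ⟨h0, h1, h2, h3⟩
    refine ⟨fun j h => ?_, fun r k h hr => ?_, fun r k h hr => ?_⟩
    · rw [← h1 j h, ne _ (by omega)]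
    · by_cases hk : r = i ∧ k = m
      · obtain ⟨rfl, rfl⟩ := hk
        exact h0
      · have := h2 r k h (by omega)
        rwa [ne _ (by omega), ne _ (by omega), ne _ (by omega)] at this
    · rw [← ne h (by omega)]
      exact h3 r k h (by omega)

/-- The weights of row `r` involve the variable `x (r - 1)` with exponent `-1` and do not involve
the variables with smaller numbers. This is preserved when the weight of an entry is added to that
of an entry above it, and guarantees that no denominator vanishes. -/
def IsLowerTriangular {n : ℕ} (ω : Idx n → Fin n → ℤ) : Prop :=
  ∀ r k h (s : Fin n), ((s : ℕ) + 1 = r → ω (pos r k h) s = -1) ∧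
    ((s : ℕ) + 1 < r → ω (pos r k h) s = 0)

theorem IsLowerTriangular.add_single {n : ℕ} {ω : Idx n → Fin n → ℤ} (hω : IsLowerTriangular ω)
    {i j m : ℕ} (hj : i + j < n) (hm : i + 1 + m < n) :
    IsLowerTriangular (ω + Pi.single (pos i j hj) (ω (pos (i + 1) m hm))) := by
  intro r k h s
  rw [Pi.add_apply]
  by_cases e : r = i ∧ k = j
  · obtain ⟨rfl, rfl⟩ := e
    rw [Pi.single_eq_same, Pi.add_apply]
    constructor <;> intro hs
    · rw [(hω r k h s).1 hs, (hω (r + 1) m hm s).2 (by omega), add_zero]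
    · rw [(hω r k h s).2 hs, (hω (r + 1) m hm s).2 (by omega), add_zero]
  · rw [Pi.single_eq_of_ne (fun e' => e (pos_inj.1 e')), add_zero]
    exact hω r k h s

theorem IsLowerTriangular.ne_zero {n : ℕ} {ω : Idx n → Fin n → ℤ} (hω : IsLowerTriangular ω)
    {i m : ℕ} (hm : i + 1 + m < n) : ω (pos (i + 1) m hm) ≠ 0 := by
  intro h
  have := (hω (i + 1) m hm ⟨i, by omega⟩).1 rfl
  simp [h] at this

theorem isLowerTriangular_specExponent (n : ℕ) : IsLowerTriangular (specExponent (n := n)) := by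
  intro r k h s
  rw [specExponent_pos, rowExp]
  constructor <;> intro hs
  · rw [if_neg (by omega), if_pos hs, zero_sub]
  · rw [if_neg (by omega), if_neg (by omega), sub_zero]

theorem rowWeights_add_single {n : ℕ} (ω : Idx n → Fin n → ℤ) {i j : ℕ} (h : i + j < n)
    (a : Fin n → ℤ) :
    rowWeights (ω + Pi.single (pos i j h) a) i = rowWeights ω i + Pi.single j a := by
  funext k
  rw [Pi.add_apply, rowWeights, rowWeights]
  split_ifs with hk
  · rw [Pi.add_apply]
    congr 1
    by_cases e : k = j
    · subst e
      simp
    · rw [Pi.single_eq_of_ne e, Pi.single_eq_of_ne (fun e' => e (pos_inj.1 e').2)]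
  · rw [Pi.single_eq_of_ne (by omega), add_zero]

theorem rowWeights_add_single_of_ne {n : ℕ} (ω : Idx n → Fin n → ℤ) {i j l : ℕ} (h : i + j < n)
    (hl : l ≠ i) (a : Fin n → ℤ) :
    rowWeights (ω + Pi.single (pos i j h) a) l = rowWeights ω l := by
  funext k
  rw [rowWeights, rowWeights]
  split_ifs with hk
  · rw [Pi.add_apply, Pi.single_eq_of_ne (fun e' => hl (pos_inj.1 e').1), add_zero]
  · rfl

open Classical in
/-- The induction step for one more entry of row `i + 1`. -/
theorem hasValue_partialTriangle_succ {n : ℕ} {top : ℕ → ℤ} {L R : ℕ → ℕ → Prop} {i m : ℕ}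
    (hm : i + 1 + m < n) (hor : L i m ∨ R i m)
    (hand : L i m → R i m → ∀ y : Idx n → ℤ, IsPartialTriangle top L R i m y →
      y (pos i (m + 1) (by omega)) ≤ y (pos i m (by omega)))
    {N : RowAlg (RatFun (Fin n)) (Fin n → ℤ) →ₗ[RatFun (Fin n)] RatFun (Fin n)}
    (ih : ∀ ω : Idx n → Fin n → ℤ, IsLowerTriangular ω →
      (∀ r k h, r < i → ω (pos r k h) = rowExp n r) →
      HasValue ω (fun y => if IsPartialTriangle top L R i m y then 1 else 0)
        (N (.single (rowWeights ω i) 1 * ∏ k ∈ Finset.range m,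
          node (expo (Fin n)) (L i k) (R i k) k (rowWeights ω (i + 1) k))))
    (ω : Idx n → Fin n → ℤ) (hω : IsLowerTriangular ω)
    (hup : ∀ r k h, r < i → ω (pos r k h) = rowExp n r) :
    HasValue ω (fun y => if IsPartialTriangle top L R i (m + 1) y then 1 else 0)
      (N (.single (rowWeights ω i) 1 * ∏ k ∈ Finset.range (m + 1),
        node (expo (Fin n)) (L i k) (R i k) k (rowWeights ω (i + 1) k))) := by
  have step : ∀ (j : ℕ) (hj : i + j < n), HasValue
      (ω + Pi.single (pos i j hj) (ω (pos (i + 1) m hm)))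
      (fun y => if IsPartialTriangle top L R i m y then 1 else 0)
      (N (.single (rowWeights ω i + Pi.single j (ω (pos (i + 1) m hm))) 1 *
        ∏ k ∈ Finset.range m,
          node (expo (Fin n)) (L i k) (R i k) k (rowWeights ω (i + 1) k))) := by
    intro j hj
    have := ih _ (hω.add_single hj hm) fun r k h hr => by
      rw [Pi.add_apply, Pi.single_eq_of_ne (fun e => hr.ne (pos_inj.1 e).1), add_zero, hup r k h hr]
    rwa [rowWeights_add_single, rowWeights_add_single_of_ne _ _ (by omega)] at this
  have h1 : pos i m (by omega) ≠ pos (i + 1) m hm := fun e => by simp [pos_inj] at e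
  have h2 : pos i (m + 1) (by omega) ≠ pos (i + 1) m hm := fun e => by simp [pos_inj] at e
  convert HasValue.addCoordinate h1 h2 (hω.ne_zero hm)
    (fun y hy => (by simpa using hy : IsPartialTriangle top L R i m y).2.2 _ _ _ (by omega)) hor
    (fun hL hR y hy => hand hL hR y (by simpa using hy))
    (step m _) (step (m + 1) _) using 1
  · funext y
    rw [isPartialTriangle_succ_iff hm]
    split_ifs <;> tauto
  · have hw : rowWeights ω (i + 1) m = ω (pos (i + 1) m hm) := by rw [rowWeights, dif_pos]
    have e : ∀ (j : ℕ) (c : RatFun (Fin n)) (P : RowAlg (RatFun (Fin n)) (Fin n → ℤ)),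
        N (.single (rowWeights ω i) 1 * (P * .single (Pi.single j (ω (pos (i + 1) m hm))) c)) =
          c * N (.single (rowWeights ω i + Pi.single j (ω (pos (i + 1) m hm))) 1 * P) := by
      intro j c P
      rw [← smul_eq_mul c, ← map_smul, mul_comm P, ← mul_assoc, AddMonoidAlgebra.single_mul_single,
        ← smul_mul_assoc, AddMonoidAlgebra.smul_single, smul_eq_mul, mul_comm c]
    rw [Finset.prod_range_succ, hw]
    generalize ∏ k ∈ Finset.range m, node (expo (Fin n)) (L i k) (R i k) k
      (rowWeights ω (i + 1) k) = P
    rw [node, mul_add, mul_add, map_add]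
    congr 1 <;> split_ifs <;> simp only [e, mul_zero, map_zero]

open Classical in
/-- The sum over the first rows of a triangle has the value recorded by `rowFunctional`. -/
theorem hasValue_partialTriangle {n : ℕ} {top : ℕ → ℤ} {L R : ℕ → ℕ → Prop}
    (htop : ∀ j, j + 1 < n → top (j + 1) ≤ top j)
    (hor : ∀ i j, i + 1 + j < n → L i j ∨ R i j)
    (hand : ∀ i j, i + 1 + 1 + j < n → L (i + 1) j → R (i + 1) j → R i j ∧ L i (j + 1))
    (i m : ℕ) (him : i + 1 + m ≤ n ∨ i ≤ n ∧ m = 0) (ω : Idx n → Fin n → ℤ)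
    (hω : IsLowerTriangular ω) (hup : ∀ r k h, r < i → ω (pos r k h) = rowExp n r) :
    HasValue ω (fun y => if IsPartialTriangle top L R i m y then 1 else 0)
      (rowFunctional n top L R i (.single (rowWeights ω i) 1 *
        ∏ k ∈ Finset.range m, node (expo (Fin n)) (L i k) (R i k) k (rowWeights ω (i + 1) k))) := by
  induction i generalizing m ω with
  | zero =>
    induction m generalizing ω with
    | zero =>
      refine ⟨1, monomial (∑ j : Fin n, Pi.single (pos 0 j (by omega)) (top j)), by simp, ?_, ?_⟩
      · rw [AddMonoidAlgebra.one_def, mulSeries_single]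
        funext y
        simp [isPartialTriangle_zero_iff, monomial, Finsupp.single_apply, eq_comm]
      · rw [Finset.prod_range_zero, mul_one, rowFunctional, functional_single, one_mul, map_one,
          weightSpec_monomial, expo_ofAdd, toRat, toRat, toRat, map_one, div_one, map_sum,
          Finset.sum_range]
        congr 3
        funext j
        rw [weightHom_single, rowWeights, dif_pos]
    | succ m ihm =>
      refine hasValue_partialTriangle_succ (by omega) (hor 0 m (by omega)) (fun _ _ y hy => ?_)
        (fun ω hω hup => ihm (by omega) ω hω hup) ω hω hup
      rw [hy.1, hy.1]
      exact htop m (by omega)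
  | succ i ihi =>
    induction m generalizing ω with
    | zero =>
      have := ihi (n - (i + 1)) (by omega) ω hω fun r k h hr => hup r k h (by omega)
      convert this using 1
      · funext y
        have e : IsPartialTriangle top L R (i + 1) 0 y ↔
            IsPartialTriangle top L R i (n - (i + 1)) y := by
          refine and_congr Iff.rfl (and_congr ?_ ?_)
          · refine forall_congr' fun r => forall_congr' fun k => forall_congr' fun h =>
              imp_congr_left (by omega)
          · refine forall_congr' fun r => forall_congr' fun k => forall_congr' fun h =>
              imp_congr_left (by omega)
        simp only [e]
      · rw [Finset.prod_range_zero, mul_one, rowFunctional, rowStep_single]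
        congr 3
        funext k
        rw [rowConst, rowWeights]
        split_ifs with h
        · rw [hup i k h (by omega)]
        · rfl
    | succ m ihm =>
      refine hasValue_partialTriangle_succ (by omega) (hor (i + 1) m (by omega))
        (fun hL hR y hy => ?_) (fun ω hω hup => ihm (by omega) ω hω hup) ω hω hup
      -- Both entries are tied to the entry of row `i` that lies above both of them.
      obtain ⟨h1, h2⟩ := hand i m (by omega) hL hR
      exact ((hy.2.1 i (m + 1) (by omega) (by omega)).1 h2).trans
        ((hy.2.1 i m (by omega) (by omega)).2 h1)

/-- The value of the sum over all triangles subject to the constraints `L`, `R` under the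
specialization of the variables. -/
def triangleValue (n : ℕ) (top : ℕ → ℤ) (L R : ℕ → ℕ → Prop) : RatFun (Fin n) :=
  rowFunctional n top L R n (.single 0 1)

/-- A set whose integer points are the triangles subject to the constraints `L`, `R` has an
integer-point transform with a specialization, which is `triangleValue`. -/
theorem specRat_transform_eq_triangleValue {n : ℕ} {top : ℕ → ℤ} {L R : ℕ → ℕ → Prop}
    (htop : ∀ j, j + 1 < n → top (j + 1) ≤ top j)
    (hor : ∀ i j, i + 1 + j < n → L i j ∨ R i j)
    (hand : ∀ i j, i + 1 + 1 + j < n → L (i + 1) j → R (i + 1) j → R i j ∧ L i (j + 1))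
    {P : Set (Idx n → ℝ)}
    (hP : ∀ y : Idx n → ℤ, toReal y ∈ P ↔ (∀ j h, y (pos 0 j h) = top j) ∧
      ∀ i j (h : i + 1 + j < n), (L i j → y (pos (i + 1) j h) ≤ y (pos i j (by omega))) ∧
        (R i j → y (pos i (j + 1) (by omega)) ≤ y (pos (i + 1) j h))) :
    (∃ Q, IsTransform P Q) ∧ (∃ S, IsSpecialization (transform P) S) ∧
      specRat (transform P) = triangleValue n top L R := by
  classical
  have hspec : weightSpec (specExponent (n := n)) = specLaurent n := rfl
  obtain ⟨q, p, hq, hm, hv⟩ := hasValue_partialTriangle htop hor hand n 0 (by omega) specExponent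
    (isLowerTriangular_specExponent n) fun r k h _ => specExponent_pos h
  have hgen : genFun P = fun y => if IsPartialTriangle top L R n 0 y then 1 else 0 := by
    funext y
    have : toReal y ∈ P ↔ IsPartialTriangle top L R n 0 y := by
      rw [hP]
      constructor
      · rintro ⟨h1, h2⟩
        exact ⟨h1, fun r k h _ => h2 r k h, fun r k h h' => absurd (by omega) h'⟩
      · rintro ⟨h1, h2, -⟩
        exact ⟨h1, fun r k h => h2 r k h (by omega)⟩
    simp only [genFun, this]
  have hq0 : q ≠ 0 := fun h => hq (by rw [h, map_zero])
  have htr : IsTransform P (toRat p / toRat q) := ⟨q, p, hq0, by rw [hgen, hm], rfl⟩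
  have hsp : IsSpecialization (transform P) (triangleValue n top L R) := by
    refine ⟨q, p, hq, htr.transform_eq, ?_⟩
    rw [← hspec, ← hv, triangleValue, Finset.prod_range_zero, mul_one]
    congr 2
    funext k
    rw [rowWeights, dif_neg (by omega)]
    rfl
  exact ⟨⟨_, htr⟩, ⟨_, hsp⟩, hsp.specRat_eq⟩

end Triangle

/-! ### The values of the tangent cones at the vertices -/

section VertexValues

/-- The top row of a triangle with the entries `lam`. -/
def topRow {n : ℕ} (lam : Fin n → ℤ) : ℕ → ℤ := fun k => if h : k < n then lam ⟨k, h⟩ else 0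

theorem topRow_lt {n : ℕ} {lam : Fin n → ℤ} (hlam : StrictAnti lam) {j k : ℕ} (hjk : j < k)
    (hk : k < n) : topRow lam k < topRow lam j := by
  rw [topRow, topRow, dif_pos hk, dif_pos (hjk.trans hk)]
  exact hlam (by simpa using hjk)

/-- The number triangles with top row `lam` (extended by `0` outside of the triangle) in which
every other entry equals one of the two entries above it. These are the vertices of the
Gelfand-Tsetlin polytope. -/
structure IsVertexTriangle {n : ℕ} (lam : Fin n → ℤ) (v : ℕ → ℕ → ℤ) : Prop where
  row_zero : v 0 = topRow lam
  step : ∀ i j, i + 1 + j < n → v (i + 1) j = v i j ∨ v (i + 1) j = v i (j + 1)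
  eq_zero : ∀ i j, n ≤ i + j → v i j = 0

/-- The value of the tangent cone at the vertex `v` under the specialization of the variables. -/
def vertexValue {n : ℕ} (lam : Fin n → ℤ) (v : ℕ → ℕ → ℤ) : RatFun (Fin n) :=
  triangleValue n (topRow lam) (fun i j => v (i + 1) j = v i j)
    (fun i j => v (i + 1) j = v i (j + 1))

/-- The triangles all of whose rows are strictly decreasing; these correspond to the simplicial
vertices. -/
def HasStrictRows (n : ℕ) (v : ℕ → ℕ → ℤ) : Prop :=
  ∀ i j, i + 1 + j < n → v i (j + 1) < v i j

namespace IsVertexTriangle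

variable {n : ℕ} {lam : Fin n → ℤ} {v : ℕ → ℕ → ℤ}

theorem row_anti (hv : IsVertexTriangle lam v) (hlam : StrictAnti lam) (i j : ℕ)
    (h : i + 1 + j < n) : v i (j + 1) ≤ v i j := by
  induction i generalizing j with
  | zero =>
    rw [hv.row_zero]
    exact (topRow_lt hlam (Nat.lt_succ_self j) (by omega)).le
  | succ i ih =>
    have h1 := ih j (by omega)
    have h2 := ih (j + 1) (by omega)
    rcases hv.step i j (by omega) with e | e <;>
      rcases hv.step i (j + 1) (by omega) with e' | e' <;> omega

theorem between (hv : IsVertexTriangle lam v) (hlam : StrictAnti lam) (i j : ℕ)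
    (h : i + 1 + j < n) : v (i + 1) j ≤ v i j ∧ v i (j + 1) ≤ v (i + 1) j := by
  have := hv.row_anti hlam i j h
  rcases hv.step i j h with e | e <;> omega

/-- An entry that equals both entries above it is squeezed between two entries which equal the
entry above both of them. -/
theorem tied (hv : IsVertexTriangle lam v) (hlam : StrictAnti lam) {i j : ℕ}
    (h : i + 1 + 1 + j < n) (h1 : v (i + 1 + 1) j = v (i + 1) j)
    (h2 : v (i + 1 + 1) j = v (i + 1) (j + 1)) :
    v (i + 1) j = v i (j + 1) ∧ v (i + 1) (j + 1) = v i (j + 1) := by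
  have := hv.between hlam i j (by omega)
  have := hv.between hlam i (j + 1) (by omega)
  omega

end IsVertexTriangle

theorem two_ne_zero_ratFun (ι : Type) : (2 : RatFun ι) ≠ 0 := by
  have h : (2 : Laurent ι) ≠ 0 := by
    have e : (2 : Laurent ι) = .single 0 2 := by
      rw [← one_add_one_eq_two, AddMonoidAlgebra.one_def, ← AddMonoidAlgebra.single_add]
      rfl
    rw [e, Ne, ← AddMonoidAlgebra.single_zero (0 : ι → ℤ), AddMonoidAlgebra.single_right_inj]
    norm_num
  have h' := toRat_ne_zero h
  rwa [toRat, map_ofNat] at h'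

/-- Once a row of `v` has two equal entries, the functional of that row and those of all later rows
are combinations of functionals that are invariant under shifted transpositions; there are none
of these in a row with one entry. -/
theorem vertexValue_eq_zero {n : ℕ} {lam : Fin n → ℤ} (hlam : StrictAnti lam) {v : ℕ → ℕ → ℤ}
    (hv : IsVertexTriangle lam v) (hns : ¬ HasStrictRows n v) : vertexValue lam v = 0 := by
  have hex : ∃ i, ∃ j, i + 1 + j < n ∧ ¬ v i (j + 1) < v i j := by
    simpa [HasStrictRows] using hns
  classical
  obtain ⟨j, hj, hij⟩ := Nat.find_spec hex
  have hmin : ∀ i < Nat.find hex, ∀ j, i + 1 + j < n → v i (j + 1) < v i j := by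
    intro i hi j hj
    by_contra h
    exact Nat.find_min hex hi ⟨j, hj, h⟩
  generalize Nat.find hex = i at hj hij hmin
  obtain _ | i := i
  · exact absurd (by rw [hv.row_zero]; exact topRow_lt hlam (Nat.lt_succ_self j) (by omega)) hij
  set N := rowFunctional n (topRow lam) (fun i j => v (i + 1) j = v i j)
    (fun i j => v (i + 1) j = v i (j + 1)) with hN
  have main : ∀ r, i + 1 ≤ r → r ≤ n → N r ∈ invariantSpan (expo (Fin n)) (n - r)
      fun j => v r j = v (r - 1) (j + 1) ∧ v r (j + 1) = v (r - 1) (j + 1) := by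
    intro r hr
    induction r, hr using Nat.le_induction with
    | base =>
      intro _
      have h1 := hv.between hlam i j (by omega)
      have h2 := hv.between hlam i (j + 1) (by omega)
      have h3 := hmin i (Nat.lt_succ_self i) j (by omega)
      have h4 := hmin i (Nat.lt_succ_self i) (j + 1) (by omega)
      have h5 : v (i + 1) j = v i (j + 1) := by omega
      have h6 : v (i + 1) (j + 1) = v i (j + 1) := by omega
      refine Submodule.subset_span ⟨j, by omega, ⟨h5, h6⟩, ?_⟩
      rw [hN, rowFunctional_succ]
      exact isTwistInvariant_rowStep _ _ _ (by omega) h5 h6 (by omega) (by omega)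
    | succ r hr ih =>
      intro hrn
      have hm : n - r = n - (r + 1) + 1 := by omega
      have := ih (by omega)
      rw [hm] at this
      rw [hN, rowFunctional_succ, ← hN, Nat.add_sub_cancel]
      have h1 : ∀ j < n - (r + 1), v r j = v (r - 1) (j + 1) ∧ v r (j + 1) = v (r - 1) (j + 1) →
          v (r + 1) j = v r j ∧ v (r + 1) j = v r (j + 1) := by
        intro j hj hT
        rcases hv.step r j (by omega) with h | h <;> constructor <;> omega
      have h2 : ∀ j < n - (r + 1), rowConst n r j = rowConst n r (j + 1) := by
        intro j hj
        rw [rowConst, rowConst, if_pos (by omega), if_pos (by omega)]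
      have h3 := two_ne_zero_ratFun (Fin n)
      have h4 := rowStep_mem_invariantSpan (expo (Fin n)) (L := fun j => v (r + 1) j = v r j)
        (R := fun j => v (r + 1) j = v r (j + 1)) (N := N r) h3 h1 h2
      have h5 := h4 this
      exact h5
  have := main n (by omega) le_rfl
  rw [invariantSpan_of_le_one _ (by omega), Submodule.mem_bot] at this
  rw [vertexValue, triangleValue, ← hN, this, LinearMap.zero_apply]

/-! ### The value at a vertex with strictly decreasing rows -/

/-- The exponent of the variable `x r`. -/
def varExp (n r : ℕ) : Fin n → ℤ := fun s => if (s : ℕ) = r then 1 else 0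

/-- The factor of Weyl's denominator, or rather its inverse, for two entries `D`, `D'` of the
weight: the sum of the geometric series with ratio `x ^ a` or `x ^ (-a)`. -/
def denomFactor {n : ℕ} (D D' : ℤ) (a : Fin n → ℤ) : RatFun (Fin n) :=
  if D < D' then geom (expo (Fin n)) (-a) else geom (expo (Fin n)) a

theorem prod_range_succ_skip {M : Type} [CommMonoid M] {m d : ℕ} (hd : d ≤ m) (f : ℕ → M) :
    ∏ k ∈ Finset.range (m + 1), f k =
      f d * ∏ k ∈ Finset.range m, f (if k < d then k else k + 1) := by
  rw [Finset.prod_range, Fin.prod_univ_succAbove _ (⟨d, by omega⟩ : Fin (m + 1)),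
    Finset.prod_range]
  congr 1
  refine Finset.prod_congr rfl fun k _ => ?_
  congr 1
  simp only [Fin.succAbove, Fin.lt_def, Fin.val_castSucc]
  split_ifs <;> rfl

theorem sum_range_succ_skip {M : Type} [AddCommMonoid M] {m d : ℕ} (hd : d ≤ m) (f : ℕ → M) :
    ∑ k ∈ Finset.range (m + 1), f k =
      f d + ∑ k ∈ Finset.range m, f (if k < d then k else k + 1) :=
  prod_range_succ_skip (M := Multiplicative M) hd f

theorem prod_single {K A ι : Type} [Field K] [AddCommGroup A] (s : Finset ι) (b : ι → A)
    (c : ι → K) : ∏ k ∈ s, (AddMonoidAlgebra.single (b k) (c k) : AddMonoidAlgebra K A) =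
      .single (∑ k ∈ s, b k) (∏ k ∈ s, c k) := by
  classical
  induction s using Finset.induction_on with
  | empty => simp [AddMonoidAlgebra.one_def]
  | insert a s ha ih =>
    rw [Finset.prod_insert ha, Finset.sum_insert ha, Finset.prod_insert ha, ih,
      AddMonoidAlgebra.single_mul_single]

/-- In a vertex triangle with strictly decreasing rows, every row arises from the previous one by
the deletion of one entry. -/
theorem IsVertexTriangle.exists_deleted {n : ℕ} {lam : Fin n → ℤ} {v : ℕ → ℕ → ℤ}
    (hv : IsVertexTriangle lam v) (hs : HasStrictRows n v) {i : ℕ} (hi : i < n) :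
    ∃ d, i + d < n ∧ ∀ k, i + 1 + k < n → v (i + 1) k = v i (if k < d then k else k + 1) := by
  classical
  by_cases hex : ∃ d, i + 1 + d < n ∧ v (i + 1) d = v i (d + 1)
  · obtain ⟨hd, hR⟩ := Nat.find_spec hex
    refine ⟨Nat.find hex, by omega, fun k hk => ?_⟩
    split_ifs with hkd
    · exact (hv.step i k hk).resolve_right fun h => Nat.find_min hex hkd ⟨hk, h⟩
    · generalize Nat.find hex = d at hd hR hkd
      obtain ⟨l, rfl⟩ := Nat.exists_eq_add_of_le (not_lt.1 hkd)
      induction l with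
      | zero => exact hR
      | succ l ih =>
        have h1 := ih (by omega) (by omega)
        refine (hv.step i _ hk).resolve_left fun h => ?_
        have h2 := hs (i + 1) (d + l) (by omega)
        have e : d + (l + 1) = d + l + 1 := rfl
        rw [e] at h
        omega
  · refine ⟨n - i - 1, by omega, fun k hk => ?_⟩
    rw [if_pos (by omega)]
    exact (hv.step i k hk).resolve_right fun h => hex ⟨k, hk, h⟩

theorem lt_of_lt_of_forall_succ_lt {m : ℕ} {f : ℕ → ℤ} (h : ∀ j, j + 1 < m → f (j + 1) < f j)
    {j k : ℕ} (hjk : j < k) (hk : k < m) : f k < f j := by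
  obtain ⟨l, rfl⟩ := Nat.exists_eq_add_of_lt hjk
  induction l with
  | zero => exact h j hk
  | succ l ih => exact (h (j + l + 1) hk).trans (ih (by omega) (by omega))

theorem HasStrictRows.lt {n : ℕ} {v : ℕ → ℕ → ℤ} (hs : HasStrictRows n v) {i j k : ℕ}
    (hjk : j < k) (hk : i + k < n) : v i k < v i j :=
  lt_of_lt_of_forall_succ_lt (m := n - i) (fun j hj => hs i j (by omega)) hjk (by omega)

/-- The functional of row `i` for a vertex with strictly decreasing rows. Row `r + 1` arises from
row `r` by the deletion of the entry `v r (d r)`. The weight of an entry of row `i` of the triangle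
contributes to all entries above it that are equal to it; hence such an entry gets the weight
`a k + x (i - 1) - x (r - 1)` in row `r`, and the entry deleted from row `s` gets
`x s - x (r - 1)`. -/
theorem rowFunctional_of_hasStrictRows {n : ℕ} {lam : Fin n → ℤ} {v : ℕ → ℕ → ℤ}
    (hv : IsVertexTriangle lam v) (hs : HasStrictRows n v) {d : ℕ → ℕ}
    (hd : ∀ i < n, i + d i < n)
    (hstep : ∀ i < n, ∀ k, i + 1 + k < n → v (i + 1) k = v i (if k < d i then k else k + 1))
    (i : ℕ) (hi : i ≤ n) (a : ℕ → Fin n → ℤ) (y : ℕ → Fin n → ℤ) (hy0 : y 0 = 0)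
    (hy : ∀ r, y (r + 1) = varExp n r) :
    rowFunctional n (topRow lam) (fun i j => v (i + 1) j = v i j)
        (fun i j => v (i + 1) j = v i (j + 1)) i (.single a 1) =
      expo (Fin n) (.ofAdd (∑ r ∈ Finset.range i, v r (d r) • varExp n r +
        ∑ k ∈ Finset.range (n - i), v i k • (a k + y i))) *
      ((∏ s ∈ Finset.range i, ∏ r ∈ Finset.range s,
        denomFactor (v r (d r)) (v s (d s)) (varExp n s - varExp n r)) *
      ∏ r ∈ Finset.range i, ∏ k ∈ Finset.range (n - i),
        denomFactor (v r (d r)) (v i k) (a k + y i - varExp n r)) := by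
  induction i generalizing a with
  | zero =>
    rw [rowFunctional, functional_single, one_mul, hv.row_zero, hy0]
    simp
  | succ i ih =>
    have hin : i < n := hi
    have hdi := hd i hin
    set m := n - (i + 1) with hm
    have hm' : n - i = m + 1 := by omega
    set σ : ℕ → ℕ := fun k => if k < d i then k else k + 1 with hσ
    have hσd : ∀ k, σ k ≠ d i := fun k => by simp only [hσ]; split_ifs <;> omega
    have hσinj : ∀ k l, σ k = σ l → k = l := fun k l => by
      simp only [hσ]
      split_ifs <;> omega
    have hσm : ∀ k < m, σ k < m + 1 := fun k hk => by simp only [hσ]; split_ifs <;> omega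
    have hvσ : ∀ k < m, v (i + 1) k = v i (σ k) := fun k hk => hstep i hin k (by omega)
    have hc : ∀ k < m + 1, rowConst n i k = varExp n i - y i := by
      intro k hk
      rw [rowConst, if_pos (by omega)]
      funext s
      rcases i with _ | i
      · simp [rowExp, varExp, hy0]
      · simp [rowExp, varExp, hy]
    have hnode : ∀ k ∈ Finset.range m,
        node (expo (Fin n)) (v (i + 1) k = v i k) (v (i + 1) k = v i (k + 1)) k (a k) =
          .single (Pi.single (σ k) (a k)) (denomFactor (v i (d i)) (v (i + 1) k) (a k)) := by
      intro k hk
      have hk := Finset.mem_range.1 hk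
      have h1 := hs i k (by omega)
      have h2 := hvσ k hk
      simp only [hσ] at h2 ⊢
      split_ifs at h2 ⊢ with hkd
      · have h3 := hs.lt hkd (i := i) (by omega)
        have h4 : v (i + 1) k ≠ v i (k + 1) := by omega
        rw [node, if_pos h2, if_neg h4, add_zero, denomFactor, if_pos (by omega)]
      · have h3 := hs.lt (show d i < k + 1 by omega) (i := i) (by omega)
        have h4 : v (i + 1) k ≠ v i k := by omega
        rw [node, if_pos h2, if_neg h4, zero_add, denomFactor, if_neg (by omega)]
    set b : ℕ → Fin n → ℤ := rowConst n i + ∑ k ∈ Finset.range m, Pi.single (σ k) (a k) with hb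
    have hbd : b (d i) + y i = varExp n i := by
      rw [hb, Pi.add_apply, Finset.sum_apply,
        Finset.sum_eq_zero fun k _ => Pi.single_eq_of_ne (hσd k).symm _, hc _ (by omega)]
      abel
    have hbσ : ∀ k < m, b (σ k) + y i = a k + y (i + 1) := by
      intro k hk
      rw [hb, Pi.add_apply, Finset.sum_apply, Finset.sum_eq_single_of_mem k (Finset.mem_range.2 hk)
        (fun l _ hl => Pi.single_eq_of_ne (fun e => hl (hσinj _ _ e).symm) _), Pi.single_eq_same,
        hc _ (hσm k hk), hy]
      abel
    have hN : rowFunctional n (topRow lam) (fun i j => v (i + 1) j = v i j)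
        (fun i j => v (i + 1) j = v i (j + 1)) (i + 1) (.single a 1) =
        (∏ k ∈ Finset.range m, denomFactor (v i (d i)) (v (i + 1) k) (a k)) *
          rowFunctional n (topRow lam) (fun i j => v (i + 1) j = v i j)
            (fun i j => v (i + 1) j = v i (j + 1)) i (.single b 1) := by
      rw [rowFunctional_succ, rowStep_single, Finset.prod_congr rfl hnode, prod_single,
        AddMonoidAlgebra.single_mul_single, one_mul, ← hb, ← smul_eq_mul, ← map_smul,
        AddMonoidAlgebra.smul_single, smul_eq_mul, mul_one]
    have hsum : ∑ k ∈ Finset.range (m + 1), v i k • (b k + y i) =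
        v i (d i) • varExp n i + ∑ k ∈ Finset.range m, v (i + 1) k • (a k + y (i + 1)) := by
      rw [sum_range_succ_skip (show d i ≤ m by omega), hbd]
      congr 1
      refine Finset.sum_congr rfl fun k hk => ?_
      have hk := Finset.mem_range.1 hk
      rw [← hbσ k hk, hvσ k hk]
    have hprod : ∀ r, ∏ k ∈ Finset.range (m + 1),
        denomFactor (v r (d r)) (v i k) (b k + y i - varExp n r) =
        denomFactor (v r (d r)) (v i (d i)) (varExp n i - varExp n r) *
          ∏ k ∈ Finset.range m,
            denomFactor (v r (d r)) (v (i + 1) k) (a k + y (i + 1) - varExp n r) := by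
      intro r
      rw [prod_range_succ_skip (show d i ≤ m by omega), hbd]
      congr 1
      refine Finset.prod_congr rfl fun k hk => ?_
      have hk := Finset.mem_range.1 hk
      rw [← hbσ k hk, hvσ k hk]
    have hlast : ∏ k ∈ Finset.range m,
        denomFactor (v i (d i)) (v (i + 1) k) (a k + y (i + 1) - varExp n i) =
        ∏ k ∈ Finset.range m, denomFactor (v i (d i)) (v (i + 1) k) (a k) := by
      simp only [hy, add_sub_cancel_right]
    rw [hN, ih hin.le, hm', hsum, Finset.prod_congr rfl fun r _ => hprod r,
      Finset.prod_mul_distrib, Finset.sum_range_succ, Finset.prod_range_succ,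
      Finset.prod_range_succ (n := i), hlast, add_assoc]
    ring

theorem vertexValue_of_hasStrictRows {n : ℕ} {lam : Fin n → ℤ} {v : ℕ → ℕ → ℤ}
    (hv : IsVertexTriangle lam v) (hs : HasStrictRows n v) {d : ℕ → ℕ}
    (hd : ∀ i < n, i + d i < n)
    (hstep : ∀ i < n, ∀ k, i + 1 + k < n → v (i + 1) k = v i (if k < d i then k else k + 1)) :
    vertexValue lam v =
      expo (Fin n) (.ofAdd (∑ r ∈ Finset.range n, v r (d r) • varExp n r)) *
      ∏ s ∈ Finset.range n, ∏ r ∈ Finset.range s,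
        denomFactor (v r (d r)) (v s (d s)) (varExp n s - varExp n r) := by
  rw [vertexValue, triangleValue, rowFunctional_of_hasStrictRows hv hs hd hstep n le_rfl 0
    (fun r => match r with
      | 0 => 0
      | r + 1 => varExp n r) rfl fun _ => rfl]
  simp

/-! ### Brion's formula for the specialized values -/

/-- A finite sequence as a sequence, extended by zero. -/
def extendRow {m : ℕ} (u : Fin m → ℤ) : ℕ → ℤ := fun k => if h : k < m then u ⟨k, h⟩ else 0

theorem extendRow_injective (m : ℕ) : Function.Injective (extendRow (m := m)) := by
  intro u u' h
  funext k
  have := congrFun h k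
  simpa [extendRow] using this

/-- The possible next rows, with `m` entries, of a vertex triangle with last row `u`. -/
def nextRows (m : ℕ) (u : ℕ → ℤ) : Finset (ℕ → ℤ) :=
  (Fintype.piFinset fun k : Fin m => ({u k, u (k + 1)} : Finset ℤ)).map
    ⟨extendRow, extendRow_injective m⟩

theorem mem_nextRows {m : ℕ} {u u' : ℕ → ℤ} : u' ∈ nextRows m u ↔
    (∀ k < m, u' k = u k ∨ u' k = u (k + 1)) ∧ ∀ k, m ≤ k → u' k = 0 := by
  simp only [nextRows, Finset.mem_map, Fintype.mem_piFinset, Finset.mem_insert,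
    Finset.mem_singleton, Function.Embedding.coeFn_mk]
  constructor
  · rintro ⟨w, hw, rfl⟩
    refine ⟨fun k hk => ?_, fun k hk => dif_neg (not_lt.2 hk)⟩
    rw [extendRow, dif_pos hk]
    exact hw ⟨k, hk⟩
  · rintro ⟨h1, h2⟩
    refine ⟨fun k => u' k, fun k => h1 k k.2, ?_⟩
    funext k
    rw [extendRow]
    split_ifs with hk
    · rfl
    · exact (h2 k (not_lt.1 hk)).symm

/-- Brion's formula for one step: a sum over segments is the sum over the choices of an end of each
segment of sums over rays (or over segments that are degenerate at the vertex). -/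
theorem rowStep_full {K A : Type} [Field K] [AddCommGroup A] (X : Multiplicative A →* K) (m : ℕ)
    (c : ℕ → A) (N : RowAlg K A →ₗ[K] K) (u : ℕ → ℤ) :
    rowStep X m (fun _ => True) (fun _ => True) c N =
      ∑ u' ∈ nextRows m u, rowStep X m (fun k => u' k = u k) (fun k => u' k = u (k + 1)) c N := by
  refine functional_ext fun a => ?_
  have e : ∀ k : Fin m, node X True True k (a k) =
      ∑ t ∈ ({u k, u (k + 1)} : Finset ℤ), node X (t = u k) (t = u (k + 1)) k (a k) := by
    intro k
    by_cases h : u k = u (k + 1)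
    · simp [h]
    · rw [Finset.sum_pair h]
      simp [node, h, Ne.symm h]
  rw [LinearMap.sum_apply, rowStep_single, Finset.prod_range, Finset.prod_congr rfl fun k _ => e k,
    Finset.prod_univ_sum, Finset.mul_sum, map_sum, nextRows, Finset.sum_map]
  refine Finset.sum_congr rfl fun w _ => ?_
  rw [rowStep_single, Finset.prod_range]
  congr 2
  refine Finset.prod_congr rfl fun k _ => ?_
  simp [extendRow]

theorem rowStep_sum {K A ι : Type} [Field K] [AddCommGroup A] (X : Multiplicative A →* K) (m : ℕ)
    (L R : ℕ → Prop) (c : ℕ → A) (s : Finset ι) (N : ι → RowAlg K A →ₗ[K] K) :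
    rowStep X m L R c (∑ t ∈ s, N t) = ∑ t ∈ s, rowStep X m L R c (N t) :=
  functional_ext fun a => by simp [rowStep_single, LinearMap.sum_apply]

theorem rowFunctional_congr {n : ℕ} (top : ℕ → ℤ) {L R L' R' : ℕ → ℕ → Prop} {i : ℕ}
    (hL : ∀ r < i, L r = L' r) (hR : ∀ r < i, R r = R' r) :
    rowFunctional n top L R i = rowFunctional n top L' R' i := by
  induction i with
  | zero => rfl
  | succ i ih =>
    rw [rowFunctional_succ, rowFunctional_succ, hL i (by omega), hR i (by omega),
      ih (fun r hr => hL r (by omega)) fun r hr => hR r (by omega)]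

open Classical in
/-- The vertex triangles truncated after row `i`, that is, with all later rows replaced by `0`. -/
def truncatedVertices {n : ℕ} (lam : Fin n → ℤ) : ℕ → Finset (ℕ → ℕ → ℤ)
  | 0 => {Pi.single 0 (topRow lam)}
  | i + 1 => (truncatedVertices lam i).biUnion fun v =>
      (nextRows (n - (i + 1)) (v i)).image fun u => Function.update v (i + 1) u

theorem mem_truncatedVertices {n : ℕ} {lam : Fin n → ℤ} {i : ℕ} {v : ℕ → ℕ → ℤ} :
    v ∈ truncatedVertices lam i ↔ v 0 = topRow lam ∧
      (∀ r < i, v (r + 1) ∈ nextRows (n - (r + 1)) (v r)) ∧ ∀ r, i < r → v r = 0 := by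
  induction i generalizing v with
  | zero =>
    rw [truncatedVertices, Finset.mem_singleton]
    constructor
    · rintro rfl
      exact ⟨Pi.single_eq_same _ _, by simp, fun r hr => Pi.single_eq_of_ne (by omega) _⟩
    · rintro ⟨h1, -, h3⟩
      funext r
      rcases Nat.eq_zero_or_pos r with rfl | hr
      · rw [h1, Pi.single_eq_same]
      · rw [h3 r hr, Pi.single_eq_of_ne (by omega)]
  | succ i ih =>
    simp only [truncatedVertices, Finset.mem_biUnion, Finset.mem_image]
    constructor
    · rintro ⟨w, hw, u, hu, rfl⟩
      obtain ⟨h1, h2, h3⟩ := ih.1 hw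
      refine ⟨by rw [Function.update_of_ne (by omega), h1], fun r hr => ?_, fun r hr => ?_⟩
      · rw [Function.update_of_ne (by omega) u w (a := r)]
        rcases (show r < i ∨ r = i by omega) with hr | rfl
        · rw [Function.update_of_ne (by omega)]
          exact h2 r hr
        · rwa [Function.update_self]
      · rw [Function.update_of_ne (by omega), h3 r (by omega)]
    · rintro ⟨h1, h2, h3⟩
      refine ⟨Function.update v (i + 1) 0, ih.2 ⟨?_, fun r hr => ?_, fun r hr => ?_⟩, v (i + 1),
        ?_, by simp⟩
      · rw [Function.update_of_ne (by omega), h1]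
      · rw [Function.update_of_ne (by omega), Function.update_of_ne (by omega)]
        exact h2 r (by omega)
      · rcases eq_or_ne r (i + 1) with rfl | hr'
        · rw [Function.update_self]
        · rw [Function.update_of_ne hr', h3 r (by omega)]
      · rw [Function.update_of_ne (by omega)]
        exact h2 i (by omega)

theorem sum_truncatedVertices_succ {n : ℕ} {lam : Fin n → ℤ} {M : Type} [AddCommMonoid M] (i : ℕ)
    (G : (ℕ → ℕ → ℤ) → M) :
    ∑ w ∈ truncatedVertices lam (i + 1), G w = ∑ v ∈ truncatedVertices lam i,
      ∑ u ∈ nextRows (n - (i + 1)) (v i), G (Function.update v (i + 1) u) := by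
  rw [Finset.sum_sigma']
  refine Finset.sum_nbij' (fun w => ⟨Function.update w (i + 1) 0, w (i + 1)⟩)
    (fun p => Function.update p.1 (i + 1) p.2) (fun w hw => ?_) (fun p hp => ?_) (fun w _ => ?_)
    (fun p hp => ?_) (fun w _ => ?_)
  · obtain ⟨h1, h2, h3⟩ := mem_truncatedVertices.1 hw
    rw [Finset.mem_sigma, mem_truncatedVertices]
    dsimp only
    refine ⟨⟨?_, fun r hr => ?_, fun r hr => ?_⟩, ?_⟩
    · rw [Function.update_of_ne (by omega), h1]
    · rw [Function.update_of_ne (by omega), Function.update_of_ne (by omega)]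
      exact h2 r (by omega)
    · rcases eq_or_ne r (i + 1) with rfl | hr'
      · rw [Function.update_self]
      · rw [Function.update_of_ne hr', h3 r (by omega)]
    · rw [Function.update_of_ne (by omega)]
      exact h2 i (by omega)
  · obtain ⟨h1, h2⟩ := Finset.mem_sigma.1 hp
    simp only [truncatedVertices, Finset.mem_biUnion, Finset.mem_image]
    exact ⟨p.1, h1, p.2, h2, rfl⟩
  · simp
  · have h := (mem_truncatedVertices.1 (Finset.mem_sigma.1 hp).1).2.2 (i + 1) (by omega)
    refine Sigma.ext ?_ (heq_of_eq ?_)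
    · simp [← h]
    · simp
  · simp

theorem mem_truncatedVertices_iff {n : ℕ} {lam : Fin n → ℤ} {v : ℕ → ℕ → ℤ} :
    v ∈ truncatedVertices lam n ↔ IsVertexTriangle lam v := by
  rw [mem_truncatedVertices]
  constructor
  · rintro ⟨h1, h2, h3⟩
    refine ⟨h1, fun i j hij => (mem_nextRows.1 (h2 i (by omega))).1 j (by omega),
      fun i j hij => ?_⟩
    rcases i with _ | i
    · rw [h1, topRow, dif_neg (by omega)]
    · by_cases hi : i < n
      · exact (mem_nextRows.1 (h2 i hi)).2 j (by omega)
      · rw [h3 (i + 1) (by omega)]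
        rfl
  · intro hv
    refine ⟨hv.row_zero, fun r _ => mem_nextRows.2 ⟨fun k hk => hv.step r k (by omega),
      fun k hk => hv.eq_zero _ _ (by omega)⟩, fun r hr => ?_⟩
    funext k
    exact hv.eq_zero r k (by omega)

/-- Brion's formula for the specialized values: the value of the polytope is the sum of the values
of the tangent cones at its vertices. -/
theorem triangleValue_eq_sum {n : ℕ} (lam : Fin n → ℤ) :
    triangleValue n (topRow lam) (fun _ _ => True) (fun _ _ => True) =
      ∑ v ∈ truncatedVertices lam n, vertexValue lam v := by
  have main : ∀ i, rowFunctional n (topRow lam) (fun _ _ => True) (fun _ _ => True) i =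
      ∑ v ∈ truncatedVertices lam i, rowFunctional n (topRow lam)
        (fun i j => v (i + 1) j = v i j) (fun i j => v (i + 1) j = v i (j + 1)) i := by
    intro i
    induction i with
    | zero =>
      rw [truncatedVertices, Finset.sum_singleton]
      rfl
    | succ i ih =>
      rw [rowFunctional_succ, ih, rowStep_sum, sum_truncatedVertices_succ]
      refine Finset.sum_congr rfl fun v _ => ?_
      rw [rowStep_full _ _ _ _ (v i)]
      refine Finset.sum_congr rfl fun u _ => ?_
      have e : ∀ r ≤ i, Function.update v (i + 1) u r = v r := fun r hr =>
        Function.update_of_ne (by omega) _ _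
      rw [rowFunctional_succ]
      congr 1
      · simp only [Function.update_self, e i le_rfl]
      · simp only [Function.update_self, e i le_rfl]
      · exact rowFunctional_congr _
          (fun r hr => by rw [e (r + 1) (by omega), e r (by omega)])
          (fun r hr => by rw [e (r + 1) (by omega), e r (by omega)])
  rw [triangleValue, main, LinearMap.sum_apply]
  rfl

end VertexValues

/-! ### Vertices and tangent cones of the Gelfand-Tsetlin polytope -/

section Geometry

variable {n : ℕ}

/-- The entry `(i, j)` of a triangle, as a linear functional (zero outside of the triangle). -/
def entry (n i j : ℕ) : (Idx n → ℝ) →ₗ[ℝ] ℝ :=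
  if h : i + j < n then LinearMap.proj (pos i j h) else 0

theorem entry_apply {i j : ℕ} (h : i + j < n) (x : Idx n → ℝ) : entry n i j x = x (pos i j h) := by
  simp [entry, h]

/-- The slack of the inequality between the entry `(i + 1, j)` and the entry `(i, j)` (for `false`)
or the entry `(i, j + 1)` (for `true`). -/
def slack (n : ℕ) : Bool → ℕ → ℕ → (Idx n → ℝ) →ₗ[ℝ] ℝ
  | false, i, j => entry n i j - entry n (i + 1) j
  | true, i, j => entry n (i + 1) j - entry n i (j + 1)

theorem ext_entry {x y : Idx n → ℝ} (h : ∀ i j, i + j < n → entry n i j x = entry n i j y) :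
    x = y := by
  funext q
  induction q using Idx.induction with
  | h i j hij => rw [← entry_apply hij x, ← entry_apply hij y, h i j hij]

/-- The number triangle given by a function on all pairs of natural numbers. -/
def toTriangle (n : ℕ) {M : Type} (v : ℕ → ℕ → M) : Idx n → M := fun q => v q.1.1 q.1.2

theorem toTriangle_pos {M : Type} (v : ℕ → ℕ → M) {i j : ℕ} (h : i + j < n) :
    toTriangle n v (pos i j h) = v i j := rfl

theorem entry_toTriangle (v : ℕ → ℕ → ℝ) {i j : ℕ} (h : i + j < n) :
    entry n i j (toTriangle n v) = v i j := by
  rw [entry_apply h, toTriangle_pos]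

theorem entry_toReal (v : ℕ → ℕ → ℤ) {i j : ℕ} (h : i + j < n) :
    entry n i j (toReal (toTriangle n v)) = v i j := by
  rw [entry_apply h, toReal, toTriangle_pos]

theorem mem_GTPolytope_iff {lam : Fin n → ℤ} {x : Idx n → ℝ} :
    x ∈ GTPolytope lam ↔ (∀ j < n, entry n 0 j x = topRow lam j) ∧
      ∀ b i j, i + 1 + j < n → 0 ≤ slack n b i j x := by
  constructor
  · rintro ⟨h1, h2⟩
    refine ⟨fun j hj => ?_, fun b i j h => ?_⟩
    · rw [entry_apply (by omega), topRow, dif_pos hj]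
      exact h1 ⟨j, hj⟩
    · cases b
      · rw [slack, LinearMap.sub_apply, entry_apply (by omega), entry_apply (by omega), sub_nonneg]
        exact (h2 i j h).1
      · rw [slack, LinearMap.sub_apply, entry_apply (by omega), entry_apply (by omega), sub_nonneg]
        exact (h2 i j h).2
  · rintro ⟨h1, h2⟩
    refine ⟨fun j => ?_, fun i j h => ⟨?_, ?_⟩⟩
    · rw [← entry_apply (show 0 + (j : ℕ) < n by omega) x, h1 j j.2, topRow, dif_pos j.2]
    · have := h2 false i j h
      rwa [slack, LinearMap.sub_apply, entry_apply (by omega), entry_apply (by omega),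
        sub_nonneg] at this
    · have := h2 true i j h
      rwa [slack, LinearMap.sub_apply, entry_apply (by omega), entry_apply (by omega),
        sub_nonneg] at this

theorem exists_pos_mul_le {κ : Type} [Finite κ] (u w : κ → ℝ) :
    ∃ s : ℝ, 0 < s ∧ ∀ k, 0 < w k → s * u k ≤ w k := by
  cases nonempty_fintype κ
  have hnn : 0 ≤ ∑ k, |u k / w k| := Finset.sum_nonneg fun k _ => abs_nonneg _
  refine ⟨(1 + ∑ k, |u k / w k|)⁻¹, by positivity, fun k hk => ?_⟩
  rw [inv_mul_le_iff₀ (by positivity)]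
  have h1 : |u k / w k| ≤ ∑ k, |u k / w k| :=
    Finset.single_le_sum (f := fun k => |u k / w k|) (fun k _ => abs_nonneg _) (Finset.mem_univ k)
  have h2 : u k / w k ≤ 1 + ∑ k, |u k / w k| := by linarith [le_abs_self (u k / w k)]
  exact (div_le_iff₀ hk).1 h2

/-- The tangent cone is described by the inequalities that are equalities at its apex. -/
theorem mem_tangentCone_iff {lam : Fin n → ℤ} {A x : Idx n → ℝ} (hA : A ∈ GTPolytope lam) :
    x ∈ tangentCone (GTPolytope lam) A ↔ (∀ j < n, entry n 0 j x = topRow lam j) ∧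
      ∀ b i j, i + 1 + j < n → slack n b i j A = 0 → 0 ≤ slack n b i j x := by
  have hA' := mem_GTPolytope_iff.1 hA
  constructor
  · rintro ⟨t, ht, y, hy, rfl⟩
    have hy' := mem_GTPolytope_iff.1 hy
    refine ⟨fun j hj => ?_, fun b i j h h0 => ?_⟩
    · rw [map_add, map_smul, map_sub, hy'.1 j hj, hA'.1 j hj]
      simp
    · rw [map_add, map_smul, map_sub, h0, zero_add, sub_zero]
      exact mul_nonneg ht (hy'.2 b i j h)
  · rintro ⟨h1, h2⟩
    obtain ⟨s, hs, hsle⟩ := exists_pos_mul_le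
      (fun k : Bool × Fin n × Fin n => -slack n k.1 k.2.1 k.2.2 (x - A))
      (fun k => slack n k.1 k.2.1 k.2.2 A)
    refine ⟨s⁻¹, (inv_pos.2 hs).le, A + s • (x - A), mem_GTPolytope_iff.2
      ⟨fun j hj => ?_, fun b i j h => ?_⟩, ?_⟩
    · rw [map_add, map_smul, map_sub, h1 j hj, hA'.1 j hj]
      simp
    · rw [map_add, map_smul, smul_eq_mul]
      rcases (hA'.2 b i j h).eq_or_lt with h0 | h0
      · rw [map_sub, ← h0, zero_add, sub_zero]
        exact mul_nonneg hs.le (h2 b i j h h0.symm)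
      · have := hsle (b, ⟨i, by omega⟩, ⟨j, by omega⟩) h0
        dsimp only at this
        linarith
    · rw [add_sub_cancel_left, inv_smul_smul₀ hs.ne']
      abel

theorem slack_toReal (v : ℕ → ℕ → ℤ) {i j : ℕ} (h : i + 1 + j < n) :
    slack n false i j (toReal (toTriangle n v)) = ((v i j - v (i + 1) j : ℤ) : ℝ) ∧
    slack n true i j (toReal (toTriangle n v)) = ((v (i + 1) j - v i (j + 1) : ℤ) : ℝ) := by
  constructor
  · rw [slack, LinearMap.sub_apply, entry_toReal v (by omega), entry_toReal v (by omega),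
      Int.cast_sub]
  · rw [slack, LinearMap.sub_apply, entry_toReal v (by omega), entry_toReal v (by omega),
      Int.cast_sub]

theorem IsVertexTriangle.mem_GTPolytope {lam : Fin n → ℤ} (hlam : StrictAnti lam)
    {v : ℕ → ℕ → ℤ} (hv : IsVertexTriangle lam v) :
    toReal (toTriangle n v) ∈ GTPolytope lam := by
  refine mem_GTPolytope_iff.2 ⟨fun j hj => ?_, fun b i j h => ?_⟩
  · rw [entry_toReal v (by omega), hv.row_zero]
  · have := hv.between hlam i j h
    cases b
    · rw [(slack_toReal v h).1]
      exact_mod_cast (by omega : 0 ≤ v i j - v (i + 1) j)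
    · rw [(slack_toReal v h).2]
      exact_mod_cast (by omega : 0 ≤ v (i + 1) j - v i (j + 1))

theorem IsVertexTriangle.mem_vertices {lam : Fin n → ℤ} (hlam : StrictAnti lam) {v : ℕ → ℕ → ℤ}
    (hv : IsVertexTriangle lam v) :
    toReal (toTriangle n v) ∈ vertices (GTPolytope lam) := by
  refine mem_extremePoints.2 ⟨hv.mem_GTPolytope hlam, fun x hx y hy hxy => ?_⟩
  obtain ⟨a, b, ha, hb, hab, hxy⟩ := hxy
  have hx' := mem_GTPolytope_iff.1 hx
  have hy' := mem_GTPolytope_iff.1 hy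
  have hsum : ∀ i j, i + j < n → a * entry n i j x + b * entry n i j y = v i j := by
    intro i j h
    rw [← entry_toReal v h, ← hxy, map_add, map_smul, map_smul, smul_eq_mul, smul_eq_mul]
  have extreme : ∀ s t : ℝ, 0 ≤ s → 0 ≤ t → a * s + b * t = 0 → s = 0 ∧ t = 0 := by
    intro s t hs ht h
    have h1 := mul_nonneg ha.le hs
    have h2 := mul_nonneg hb.le ht
    exact ⟨(mul_eq_zero.1 (show a * s = 0 by linarith)).resolve_left ha.ne',
      (mul_eq_zero.1 (show b * t = 0 by linarith)).resolve_left hb.ne'⟩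
  have key : ∀ i j, i + j < n → entry n i j x = v i j ∧ entry n i j y = v i j := by
    intro i
    induction i with
    | zero =>
      intro j h
      rw [hv.row_zero]
      exact ⟨hx'.1 j (by omega), hy'.1 j (by omega)⟩
    | succ i ih =>
      intro j h
      have h0 := hsum (i + 1) j h
      have h1 := ih j (by omega)
      have h2 := ih (j + 1) (by omega)
      have hx1 := hx'.2 false i j h
      have hx2 := hx'.2 true i j h
      have hy1 := hy'.2 false i j h
      have hy2 := hy'.2 true i j h
      simp only [slack, LinearMap.sub_apply, h1.1, h2.1, h1.2, h2.2] at hx1 hx2 hy1 hy2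
      rcases hv.step i j h with e | e <;> rw [e] at h0 ⊢
      · have := extreme _ _ hx1 hy1 (by linear_combination (v i j : ℝ) * hab - h0)
        constructor <;> linarith
      · have := extreme _ _ hx2 hy2 (by linear_combination -(v i (j + 1) : ℝ) * hab + h0)
        constructor <;> linarith
  refine ⟨?_, ?_⟩ <;> refine ext_entry fun i j h => ?_
  · rw [(key i j h).1, entry_toReal v h]
  · rw [(key i j h).2, entry_toReal v h]

/-- At a vertex, every entry outside of the top row equals an entry above it: otherwise all entries
of the same value in this and the later rows could be moved simultaneously in both directions. -/
theorem entry_eq_or_eq_of_mem_vertices {lam : Fin n → ℤ} {x : Idx n → ℝ}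
    (hx : x ∈ vertices (GTPolytope lam)) {i j : ℕ} (h : i + 1 + j < n) :
    entry n (i + 1) j x = entry n i j x ∨ entry n (i + 1) j x = entry n i (j + 1) x := by
  obtain ⟨hxP, hext⟩ := mem_extremePoints.1 hx
  obtain ⟨htop, hsl⟩ := mem_GTPolytope_iff.1 hxP
  by_contra! hne
  have hb1 := hsl false i j h
  have hb2 := hsl true i j h
  simp only [slack, LinearMap.sub_apply, sub_nonneg] at hb1 hb2
  have hlt1 := lt_of_le_of_ne hb1 hne.1
  have hlt2 := lt_of_le_of_ne hb2 hne.2.symm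
  set c := entry n (i + 1) j x with hc
  -- No entry of row `i` has the value `c`.
  have hrow : ∀ k l, k + l + i < n → entry n i (k + l) x ≤ entry n i k x := by
    intro k l
    induction l with
    | zero => intro _; exact le_rfl
    | succ l ih =>
      intro hkl
      have h1 := hsl false i (k + l) (by omega)
      have h2 := hsl true i (k + l) (by omega)
      simp only [slack, LinearMap.sub_apply, sub_nonneg] at h1 h2
      exact (h2.trans h1).trans (ih (by omega))
  have hrowne : ∀ k, i + k < n → entry n i k x ≠ c := by
    intro k hk
    rcases Nat.lt_or_ge j k with hjk | hjk
    · obtain ⟨l, rfl⟩ := Nat.exists_eq_add_of_le hjk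
      exact ((hrow (j + 1) l (by omega)).trans_lt hlt2).ne
    · obtain ⟨l, rfl⟩ := Nat.exists_eq_add_of_le hjk
      exact (hlt1.trans_le (hrow k l (by omega))).ne'
  classical
  set e : ℕ → ℕ → ℝ := fun r k => if i < r ∧ entry n r k x = c then 1 else 0 with he
  have he01 : ∀ r k, 0 ≤ e r k ∧ e r k ≤ 1 := fun r k => by
    simp only [he]
    split_ifs <;> norm_num
  obtain ⟨s, hs, hsle⟩ := exists_pos_mul_le (fun _ : Bool × Fin n × Fin n => (1 : ℝ))
    (fun k => slack n k.1 k.2.1 k.2.2 x)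
  have hmove : ∀ t : ℝ, |t| ≤ s → x + t • toTriangle n e ∈ GTPolytope lam := by
    intro t ht
    refine mem_GTPolytope_iff.2 ⟨fun k hk => ?_, fun b r k hk => ?_⟩
    · rw [map_add, map_smul, entry_toTriangle e (by omega), htop k hk]
      simp [he]
    · have hloose : 0 < slack n b r k x → |t| ≤ slack n b r k x := fun h0 => by
        have := hsle (b, ⟨r, by omega⟩, ⟨k, by omega⟩) h0
        dsimp only at this
        linarith
      have hab := abs_le.1 (le_refl |t|)
      have bound : ∀ y z : ℝ, (0 ≤ y ∧ y ≤ 1) → (0 ≤ z ∧ z ≤ 1) → -|t| ≤ t * (y - z) := by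
        intro y z hy hz
        have h1 : |y - z| ≤ 1 := abs_le.2 ⟨by linarith [hy.1, hz.2], by linarith [hy.2, hz.1]⟩
        have h2 := neg_abs_le (t * (y - z))
        rw [abs_mul] at h2
        nlinarith [abs_nonneg t]
      rw [map_add, map_smul, smul_eq_mul]
      rcases (hsl b r k hk).eq_or_lt with h0 | h0
      · -- Two entries of the same value are moved together.
        suffices slack n b r k (toTriangle n e) = 0 by rw [this, ← h0]; simp
        cases b
        · simp only [slack, LinearMap.sub_apply] at h0 ⊢
          rw [entry_toTriangle e (by omega), entry_toTriangle e (by omega), sub_eq_zero]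
          have h3 := hrowne k
          have h4 : entry n r k x = entry n (r + 1) k x := by linarith
          simp only [he, ← h4]
          rcases lt_trichotomy r i with hr | rfl | hr
          · rw [if_neg (by omega), if_neg (by omega)]
          · rw [if_neg (by omega), if_neg (fun h5 => h3 (by omega) h5.2)]
          · simp [hr, show i < r + 1 by omega]
        · simp only [slack, LinearMap.sub_apply] at h0 ⊢
          rw [entry_toTriangle e (by omega), entry_toTriangle e (by omega), sub_eq_zero]
          have h3 := hrowne (k + 1)
          have h4 : entry n (r + 1) k x = entry n r (k + 1) x := by linarith
          simp only [he, h4]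
          rcases lt_trichotomy r i with hr | rfl | hr
          · rw [if_neg (by omega), if_neg (by omega)]
          · rw [if_neg (fun h5 => h3 (by omega) h5.2), if_neg (by omega)]
          · simp [hr, show i < r + 1 by omega]
      · have h1 := hloose h0
        cases b
        · simp only [slack, LinearMap.sub_apply] at h1 ⊢
          rw [entry_toTriangle e (by omega), entry_toTriangle e (by omega)]
          linarith [bound _ _ (he01 r k) (he01 (r + 1) k)]
        · simp only [slack, LinearMap.sub_apply] at h1 ⊢
          rw [entry_toTriangle e (by omega), entry_toTriangle e (by omega)]
          linarith [bound _ _ (he01 (r + 1) k) (he01 r (k + 1))]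
  have h1 := hmove s (abs_of_pos hs).le
  have h2 := hmove (-s) (by rw [abs_neg, abs_of_pos hs])
  have h3 := (hext _ h1 _ h2 ⟨1 / 2, 1 / 2, by norm_num, by norm_num, by norm_num, by module⟩).1
  have h4 := congrArg (entry n (i + 1) j) h3
  rw [map_add, map_smul, entry_toTriangle e h] at h4
  have h5 : e (i + 1) j = 1 := by simp [he, hc]
  rw [h5] at h4
  simp only [smul_eq_mul, mul_one] at h4
  linarith

theorem mem_vertices_iff {lam : Fin n → ℤ} (hlam : StrictAnti lam) {x : Idx n → ℝ} :
    x ∈ vertices (GTPolytope lam) ↔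
      ∃ v, IsVertexTriangle lam v ∧ toReal (toTriangle n v) = x := by
  constructor
  · intro hx
    have htop := (mem_GTPolytope_iff.1 (mem_extremePoints.1 hx).1).1
    set v : ℕ → ℕ → ℤ := fun i j => if i + j < n then ⌊entry n i j x⌋ else 0 with hv
    have key : ∀ i j, i + j < n → (v i j : ℝ) = entry n i j x := by
      intro i
      induction i with
      | zero =>
        intro j h
        simp only [hv, if_pos h, htop j (by omega), Int.floor_intCast]
      | succ i ih =>
        intro j h
        simp only [hv, if_pos h]
        rcases entry_eq_or_eq_of_mem_vertices hx h with e | e <;> rw [e, ← ih _ (by omega),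
          Int.floor_intCast]
    refine ⟨v, ⟨?_, fun i j h => ?_, fun i j h => if_neg (by omega)⟩, ext_entry fun i j h => ?_⟩
    · funext j
      by_cases h : j < n
      · have := key 0 j (by omega)
        rw [htop j h] at this
        exact_mod_cast this
      · simp only [hv, topRow]
        rw [if_neg (by omega), dif_neg h]
    · have h1 := entry_eq_or_eq_of_mem_vertices hx h
      rw [← key _ _ (by omega), ← key _ _ (by omega), ← key _ _ (by omega)] at h1
      exact_mod_cast h1
    · rw [entry_toReal v h, key i j h]
  · rintro ⟨v, hv, rfl⟩
    exact hv.mem_vertices hlam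

theorem IsVertexTriangle.toReal_injective {lam : Fin n → ℤ} {v v' : ℕ → ℕ → ℤ}
    (hv : IsVertexTriangle lam v) (hv' : IsVertexTriangle lam v')
    (h : toReal (toTriangle n v) = toReal (toTriangle n v')) : v = v' := by
  funext i j
  by_cases hij : i + j < n
  · have := congrArg (entry n i j) h
    rw [entry_toReal v hij, entry_toReal v' hij] at this
    exact_mod_cast this
  · rw [hv.eq_zero i j (by omega), hv'.eq_zero i j (by omega)]

end Geometry

/-! ### Simplicial vertices -/

section Simplicial

variable {n : ℕ}

/-- Coordinates adapted to a vertex at which every entry outside of the top row equals exactly one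
of the entries above it: the slacks of these equalities, and the top row. -/
def coneCoord (n : ℕ) (v : ℕ → ℕ → ℤ) : ℕ → ℕ → (Idx n → ℝ) →ₗ[ℝ] ℝ
  | 0, j => entry n 0 j
  | i + 1, j => open Classical in
    if v (i + 1) j = v i j then slack n false i j else slack n true i j

theorem coneCoord_injective {v : ℕ → ℕ → ℤ} {x : Idx n → ℝ}
    (h : ∀ i j, i + j < n → coneCoord n v i j x = 0) : x = 0 := by
  refine ext_entry fun i => ?_
  induction i with
  | zero =>
    intro j hj
    rw [map_zero]
    exact h 0 j hj
  | succ i ih =>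
    intro j hj
    have h0 := h (i + 1) j hj
    have h1 := ih j (by omega)
    have h2 := ih (j + 1) (by omega)
    rw [map_zero] at h1 h2 ⊢
    rw [coneCoord] at h0
    split_ifs at h0 <;> simp only [slack, LinearMap.sub_apply] at h0 <;> linarith

theorem mem_tangentCone_iff_coneCoord {lam : Fin n → ℤ} (hlam : StrictAnti lam) {v : ℕ → ℕ → ℤ}
    (hv : IsVertexTriangle lam v) (hs : HasStrictRows n v) {x : Idx n → ℝ} :
    x ∈ tangentCone (GTPolytope lam) (toReal (toTriangle n v)) ↔
      (∀ j, 0 + j < n → coneCoord n v 0 j (x - toReal (toTriangle n v)) = 0) ∧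
      ∀ i j, i + 1 + j < n → 0 ≤ coneCoord n v (i + 1) j (x - toReal (toTriangle n v)) := by
  rw [mem_tangentCone_iff (hv.mem_GTPolytope hlam)]
  refine and_congr (forall_congr' fun j => ?_) ?_
  · rw [zero_add]
    refine imp_congr_right fun hj => ?_
    rw [coneCoord, map_sub, entry_toReal v (by omega), hv.row_zero, sub_eq_zero]
  · have key : ∀ i j, i + 1 + j < n →
        ((∀ b, slack n b i j (toReal (toTriangle n v)) = 0 → 0 ≤ slack n b i j x) ↔
        0 ≤ coneCoord n v (i + 1) j (x - toReal (toTriangle n v))) := by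
      intro i j h
      have h1 := hs i j h
      have h2 := hv.step i j h
      rw [Bool.forall_bool, (slack_toReal v h).1, (slack_toReal v h).2, Int.cast_eq_zero,
        Int.cast_eq_zero, coneCoord]
      split_ifs with h3
      · rw [map_sub, (slack_toReal v h).1, h3, sub_self, Int.cast_zero, sub_zero]
        have h4 : v i j - v i (j + 1) ≠ 0 := by omega
        simp [h4]
      · have h4 := h2.resolve_left h3
        rw [map_sub, (slack_toReal v h).2, h4, sub_self, Int.cast_zero, sub_zero]
        have h5 : v i j - v i (j + 1) ≠ 0 := by omega
        simp [h5]
    exact ⟨fun H i j h => (key i j h).1 fun b => H b i j h,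
      fun H b i j h => (key i j h).2 (H i j h) b⟩

theorem isSimplicialVertex_of_hasStrictRows {lam : Fin n → ℤ} (hlam : StrictAnti lam)
    {v : ℕ → ℕ → ℤ} (hv : IsVertexTriangle lam v) (hs : HasStrictRows n v) :
    IsSimplicialVertex (GTPolytope lam) (toReal (toTriangle n v)) := by
  refine ⟨hv.mem_vertices hlam, ?_⟩
  classical
  set A := toReal (toTriangle n v)
  set Φ₀ : (Idx n → ℝ) →ₗ[ℝ] (Idx n → ℝ) := LinearMap.pi fun q => coneCoord n v q.1.1 q.1.2
  have hΦ₀ : Function.Injective Φ₀ := by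
    rw [injective_iff_map_eq_zero]
    exact fun x hx => coneCoord_injective fun i j h => congrFun hx (pos i j h)
  set Φ := LinearEquiv.ofInjectiveEndo Φ₀ hΦ₀
  have hΦ : ∀ x q, Φ x q = coneCoord n v q.1.1 q.1.2 x := fun x q => rfl
  let S : Type := {q : Idx n // 0 < (q.1.1 : ℕ)}
  let e : Fin (Fintype.card S) ≃ S := (Fintype.equivFin S).symm
  have hΦsum : ∀ (c : Fin (Fintype.card S) → ℝ) (q : Idx n),
      Φ (∑ k, c k • Φ.symm (Pi.single (e k).1 1)) q =
        if h : 0 < (q.1.1 : ℕ) then c (e.symm ⟨q, h⟩) else 0 := by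
    intro c q
    simp only [map_sum, map_smul, LinearEquiv.apply_symm_apply, Finset.sum_apply, Pi.smul_apply,
      smul_eq_mul]
    split_ifs with h
    · rw [Finset.sum_eq_single (e.symm ⟨q, h⟩)]
      · simp
      · intro k _ hk
        rw [Pi.single_eq_of_ne, mul_zero]
        rintro rfl
        exact hk (by simp)
      · simp
    · refine Finset.sum_eq_zero fun k _ => ?_
      rw [Pi.single_eq_of_ne, mul_zero]
      rintro rfl
      exact h (e k).2
  refine ⟨Fintype.card S, fun k => Φ.symm (Pi.single (e k).1 1), ?_, ?_⟩
  · have h := ((Pi.basisFun ℝ (Idx n)).map Φ.symm).linearIndependent.comp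
      (fun k => (e k).1) (Subtype.val_injective.comp e.injective)
    have e1 : (fun k => Φ.symm (Pi.single (e k).1 1)) =
        ((Pi.basisFun ℝ (Idx n)).map Φ.symm) ∘ fun k => (e k).1 := by
      funext k
      simp
    rw [e1]
    exact h
  · ext x
    rw [mem_tangentCone_iff_coneCoord hlam hv hs, Set.mem_ofPred_eq]
    constructor
    · rintro ⟨h1, h2⟩
      refine ⟨fun k => Φ (x - A) (e k).1, fun k => ?_, ?_⟩
      · have hpos := (e k).2
        dsimp only
        rw [hΦ]
        generalize (e k).1 = q at hpos
        induction q using Idx.induction with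
        | h i j hij =>
          obtain ⟨i, rfl⟩ := Nat.exists_eq_succ_of_ne_zero (Nat.pos_iff_ne_zero.1 hpos)
          exact h2 i j hij
      · rw [← sub_eq_iff_eq_add']
        refine Φ.injective (funext fun q => ?_)
        rw [hΦsum]
        split_ifs with h
        · simp
        · induction q using Idx.induction with
          | h i j hij =>
            obtain rfl : i = 0 := Nat.eq_zero_of_not_pos h
            exact h1 j hij
    · rintro ⟨c, hc, hx⟩
      have hx' : x - A = ∑ k, c k • Φ.symm (Pi.single (e k).1 1) := by rw [hx, add_sub_cancel_left]
      refine ⟨fun j hj => ?_, fun i j hij => ?_⟩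
      · have := hΦsum c (pos 0 j hj)
        rw [← hx', hΦ] at this
        exact this
      · have := hΦsum c (pos (i + 1) j hij)
        rw [← hx', hΦ] at this
        refine le_of_le_of_eq ?_ this.symm
        split_ifs
        · exact hc _
        · exact le_rfl

/-- Four functionals which define different facets of a simplicial cone are, up to positive factors,
different coordinates, and hence cannot satisfy the relation `φ 0 + φ 1 = φ 2 + φ 3`. Here `y s` is
a point of the facet defined by `φ s` that lies in the cone together with a neighbourhood of it in
the facet. -/
theorem false_of_simplicial_facets {E : Type} [AddCommGroup E] [Module ℝ E] {d : ℕ}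
    {ε : Fin d → E} (hε : LinearIndependent ℝ ε) {K : Set E}
    (hK : K = {x | ∃ c : Fin d → ℝ, (∀ i, 0 ≤ c i) ∧ x = ∑ i, c i • ε i})
    {φ : Fin 4 → E →ₗ[ℝ] ℝ} (hφ : ∀ s, ∀ x ∈ K, 0 ≤ φ s x) (hrel : φ 0 + φ 1 = φ 2 + φ 3)
    {y : Fin 4 → E} (hyK : ∀ s, y s ∈ K) (hy0 : ∀ s, φ s (y s) = 0)
    (hy1 : ∀ s t, s ≠ t → 0 < φ t (y s))
    (hyK' : ∀ s, ∀ z ∈ Submodule.span ℝ K, φ s z = 0 → ∃ r : ℝ, 0 < r ∧ y s + r • z ∈ K) :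
    False := by
  have hcoord : ∀ (a b : Fin d → ℝ), ∑ i, a i • ε i = ∑ i, b i • ε i → a = b := by
    intro a b h
    have h0 : ∑ i, (a i - b i) • ε i = 0 := by
      simp only [sub_smul, Finset.sum_sub_distrib, h, sub_self]
    funext i
    exact sub_eq_zero.1 (Fintype.linearIndependent_iff.1 hε _ h0 i)
  have hεK : ∀ i, ε i ∈ K := by
    intro i
    rw [hK]
    refine ⟨Pi.single i 1, fun j => ?_, by simp [Pi.single_apply]⟩
    rw [Pi.single_apply]
    split_ifs <;> norm_num
  have hyc : ∀ s, ∃ c : Fin d → ℝ, (∀ i, 0 ≤ c i) ∧ y s = ∑ i, c i • ε i := fun s => by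
    have := hyK s
    rwa [hK] at this
  choose c hc hyc using hyc
  have hφy : ∀ s t, φ t (y s) = ∑ i, c s i * φ t (ε i) := fun s t => by
    rw [hyc s, map_sum]
    simp
  -- The coordinates on which `φ s` depends vanish at `y s`.
  have hzero : ∀ s i, 0 < φ s (ε i) → c s i = 0 := by
    intro s i hi
    have h := hφy s s
    rw [hy0, eq_comm, Finset.sum_eq_zero_iff_of_nonneg fun i _ =>
      mul_nonneg (hc s i) (hφ s _ (hεK i))] at h
    exact (mul_eq_zero.1 (h i (Finset.mem_univ i))).resolve_right hi.ne'
  -- There is at most one of them, because `y s` is an inner point of its facet.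
  have huniq : ∀ s i j, 0 < φ s (ε i) → 0 < φ s (ε j) → i = j := by
    intro s i j hi hj
    by_contra hij
    obtain ⟨r, hr, hm⟩ := hyK' s (φ s (ε j) • ε i - φ s (ε i) • ε j)
      (sub_mem (Submodule.smul_mem _ _ (Submodule.subset_span (hεK i)))
        (Submodule.smul_mem _ _ (Submodule.subset_span (hεK j))))
      (by simp only [map_sub, map_smul, smul_eq_mul]; ring)
    rw [hK] at hm
    obtain ⟨c', hc', e⟩ := hm
    have e' : ∑ k, (c s k + (Pi.single i (r * φ s (ε j)) : Fin d → ℝ) k -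
        (Pi.single j (r * φ s (ε i)) : Fin d → ℝ) k) • ε k = ∑ k, c' k • ε k := by
      rw [← e, hyc s]
      simp only [sub_smul, add_smul, Finset.sum_sub_distrib, Finset.sum_add_distrib,
        Pi.single_apply, ite_smul, zero_smul, Finset.sum_ite_eq', Finset.mem_univ, if_true,
        smul_sub, smul_smul]
      abel
    have h := congrFun (hcoord _ _ e') j
    rw [Pi.single_eq_same, Pi.single_eq_of_ne (Ne.symm hij), hzero s j hj] at h
    have := hc' j
    have := mul_pos hr hi
    linarith
  have hex : ∀ s, ∃ i, 0 < φ s (ε i) := by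
    intro s
    by_contra! h
    obtain ⟨t, ht⟩ := exists_ne s
    have h1 := hy1 t s ht
    rw [hφy] at h1
    exact absurd h1 (not_lt.2 (Finset.sum_nonpos fun i _ =>
      mul_nonpos_of_nonneg_of_nonpos (hc t i) (h i)))
  choose k hk using hex
  have hkne : ∀ s t i, s ≠ t → 0 < φ s (ε i) → 0 < φ t (ε i) → False := by
    intro s t i hst hs ht
    have h1 := hy1 s t hst
    rw [hφy, Finset.sum_eq_zero] at h1
    · exact lt_irrefl _ h1
    · intro j _
      rcases (hφ t _ (hεK j)).eq_or_lt with h | h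
      · rw [← h, mul_zero]
      · rw [huniq t j i h ht, hzero s i hs, zero_mul]
  have h := LinearMap.congr_fun hrel (ε (k 0))
  simp only [LinearMap.add_apply] at h
  have h0 := hk 0
  have h1 := hφ 1 _ (hεK (k 0))
  rcases (hφ 2 _ (hεK (k 0))).eq_or_lt with h2 | h2
  · rcases (hφ 3 _ (hεK (k 0))).eq_or_lt with h3 | h3
    · linarith
    · exact hkne 0 3 _ (by decide) h0 h3
  · exact hkne 0 2 _ (by decide) h0 h2

/-- The triangle with a given top row in which the entry `(i + 1, j)` divides the segment between
the two entries above it in the ratio given by `θ i j`. -/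
def divisionTriangle (top : ℕ → ℝ) (θ : ℕ → ℕ → ℝ) : ℕ → ℕ → ℝ
  | 0, j => top j
  | i + 1, j => (1 - θ i j) * divisionTriangle top θ i j + θ i j * divisionTriangle top θ i (j + 1)

theorem divisionTriangle_lt {top : ℕ → ℝ} (htop : ∀ j, j + 1 < n → top (j + 1) < top j)
    {θ : ℕ → ℕ → ℝ} (h0 : ∀ i j, 0 ≤ θ i j) (h1 : ∀ i j, θ i j ≤ 1)
    (hθ : ∀ i j, θ i j < 1 ∨ 0 < θ i (j + 1)) (i j : ℕ) (h : i + 1 + j < n) :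
    divisionTriangle top θ i (j + 1) < divisionTriangle top θ i j := by
  induction i generalizing j with
  | zero => exact htop j (by omega)
  | succ i ih =>
    have ha := ih j (by omega)
    have hb := ih (j + 1) (by omega)
    simp only [divisionTriangle]
    have h2 := mul_nonneg (sub_nonneg.2 (h1 i j)) (sub_nonneg.2 ha.le)
    have h3 := mul_nonneg (h0 i (j + 1)) (sub_nonneg.2 hb.le)
    rcases hθ i j with h4 | h4
    · have := mul_pos (sub_pos.2 h4) (sub_pos.2 ha)
      linarith
    · have := mul_pos h4 (sub_pos.2 hb)
      linarith

/-- Each of the inequalities that define the polytope is an equality at some point of the polytope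
at which all the others are strict. -/
theorem exists_mem_facet {lam : Fin n → ℤ} (hlam : StrictAnti lam) (b : Bool) (i j : ℕ)
    (h : i + 1 + j < n) :
    ∃ y ∈ GTPolytope lam, slack n b i j y = 0 ∧
      ∀ b' i' j', i' + 1 + j' < n → (b', i', j') ≠ (b, i, j) → 0 < slack n b' i' j' y := by
  set θ : ℕ → ℕ → ℝ := fun i' j' => if i' = i ∧ j' = j then (if b then 1 else 0) else 1 / 2 with hθ
  have h0 : ∀ i j, 0 ≤ θ i j := fun i j => by simp only [hθ]; split_ifs <;> norm_num
  have h1 : ∀ i j, θ i j ≤ 1 := fun i j => by simp only [hθ]; split_ifs <;> norm_num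
  have h01 : ∀ i j, θ i j < 1 ∨ 0 < θ i (j + 1) := by
    intro i' j'
    simp only [hθ]
    by_cases e : i' = i ∧ j' = j
    · right
      rw [if_neg (by omega)]
      norm_num
    · left
      rw [if_neg e]
      norm_num
  set p := divisionTriangle (fun j => (topRow lam j : ℝ)) θ with hp
  have hlt : ∀ i j, i + 1 + j < n → p i (j + 1) < p i j := divisionTriangle_lt
    (fun j hj => by exact_mod_cast topRow_lt hlam (Nat.lt_succ_self j) hj) h0 h1 h01
  have hs : ∀ i' j', i' + 1 + j' < n →
      slack n false i' j' (toTriangle n p) = θ i' j' * (p i' j' - p i' (j' + 1)) ∧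
      slack n true i' j' (toTriangle n p) = (1 - θ i' j') * (p i' j' - p i' (j' + 1)) := by
    intro i' j' h'
    simp only [slack, LinearMap.sub_apply]
    rw [entry_toTriangle p (by omega), entry_toTriangle p h', entry_toTriangle p (by omega)]
    have e : p (i' + 1) j' = (1 - θ i' j') * p i' j' + θ i' j' * p i' (j' + 1) := rfl
    rw [e]
    constructor <;> ring
  have hz : slack n b i j (toTriangle n p) = 0 := by
    cases b
    · rw [(hs i j h).1]
      simp [hθ]
    · rw [(hs i j h).2]
      simp [hθ]
  have hpos : ∀ b' i' j', i' + 1 + j' < n → (b', i', j') ≠ (b, i, j) →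
      0 < slack n b' i' j' (toTriangle n p) := by
    intro b' i' j' h' hne
    have hd := sub_pos.2 (hlt i' j' h')
    cases b'
    · rw [(hs i' j' h').1]
      refine mul_pos ?_ hd
      simp only [hθ]
      split_ifs with e hb
      · norm_num
      · refine absurd ?_ hne
        simp [e, hb]
      · norm_num
    · rw [(hs i' j' h').2]
      refine mul_pos ?_ hd
      simp only [hθ]
      split_ifs with e hb
      · refine absurd ?_ hne
        simp [e, hb]
      · norm_num
      · norm_num
  refine ⟨toTriangle n p, mem_GTPolytope_iff.2 ⟨fun j hj => ?_, fun b' i' j' h' => ?_⟩, hz, hpos⟩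
  · rw [entry_toTriangle p (by omega)]
    rfl
  · by_cases e : (b', i', j') = (b, i, j)
    · simp only [Prod.mk.injEq] at e
      obtain ⟨rfl, rfl, rfl⟩ := e
      exact hz.ge
    · exact (hpos b' i' j' h' e).le

theorem hasStrictRows_of_isSimplicialVertex {lam : Fin n → ℤ} (hlam : StrictAnti lam)
    {v : ℕ → ℕ → ℤ} (hv : IsVertexTriangle lam v)
    (hsimp : IsSimplicialVertex (GTPolytope lam) (toReal (toTriangle n v))) :
    HasStrictRows n v := by
  intro i j h
  by_contra hle
  have heq : v i (j + 1) = v i j := le_antisymm (hv.row_anti hlam i j h) (not_lt.1 hle)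
  obtain _ | i := i
  · rw [hv.row_zero] at hle
    exact hle (topRow_lt hlam (Nat.lt_succ_self j) (by omega))
  obtain ⟨-, d, ε, hε, hcone⟩ := hsimp
  set A := toReal (toTriangle n v) with hA
  have hAP : A ∈ GTPolytope lam := hv.mem_GTPolytope hlam
  have hAP' := mem_GTPolytope_iff.1 hAP
  set K : Set (Idx n → ℝ) := {x | ∃ c : Fin d → ℝ, (∀ i, 0 ≤ c i) ∧ x = ∑ i, c i • ε i} with hK
  have hmemK : ∀ x, x ∈ K ↔ (∀ j < n, entry n 0 j x = 0) ∧
      ∀ b i j, i + 1 + j < n → slack n b i j A = 0 → 0 ≤ slack n b i j x := by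
    intro x
    have h1 : x ∈ K ↔ A + x ∈ tangentCone (GTPolytope lam) A := by
      rw [hcone]
      simp only [hK, Set.mem_ofPred_eq, add_right_inj]
    rw [h1, mem_tangentCone_iff hAP]
    refine and_congr (forall_congr' fun j => imp_congr_right fun hj => ?_)
      (forall_congr' fun b => forall_congr' fun i => forall_congr' fun j =>
        imp_congr_right fun _ => imp_congr_right fun h0 => ?_)
    · rw [map_add, hAP'.1 j hj, add_eq_left]
    · rw [map_add, h0, zero_add]
  -- The four inequalities between the entries of a small diamond of four equal entries.
  set f : Fin 4 → Bool × ℕ × ℕ :=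
    ![(false, i + 1, j), (true, i + 1, j), (true, i, j), (false, i, j + 1)] with hf
  have hfn : ∀ s, (f s).2.1 + 1 + (f s).2.2 < n := by
    intro s
    fin_cases s <;> simp [hf] <;> omega
  have hfinj : ∀ s t, s ≠ t → f t ≠ f s := by
    intro s t hst
    fin_cases s <;> fin_cases t <;> simp [hf] at hst ⊢
  have hf0 : ∀ s, slack n (f s).1 (f s).2.1 (f s).2.2 A = 0 := by
    have h1 := hv.between hlam i j (by omega)
    have h2 := hv.between hlam i (j + 1) (by omega)
    have h3 := hv.between hlam (i + 1) j h
    intro s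
    fin_cases s
    · exact (slack_toReal v h).1.trans (by rw [Int.cast_eq_zero]; omega)
    · exact (slack_toReal v h).2.trans (by rw [Int.cast_eq_zero]; omega)
    · exact (slack_toReal v (show i + 1 + j < n by omega)).2.trans
        (by rw [Int.cast_eq_zero]; omega)
    · exact (slack_toReal v (show i + 1 + (j + 1) < n by omega)).1.trans
        (by rw [Int.cast_eq_zero]; omega)
  choose y hyP hy0 hy1 using fun s => exists_mem_facet hlam (f s).1 (f s).2.1 (f s).2.2 (hfn s)
  have hyP' := fun s => mem_GTPolytope_iff.1 (hyP s)
  have hentry : ∀ s, ∀ j < n, entry n 0 j (y s - A) = 0 := fun s j hj => by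
    rw [map_sub, (hyP' s).1 j hj, hAP'.1 j hj, sub_self]
  refine false_of_simplicial_facets hε hK
    (φ := fun s => slack n (f s).1 (f s).2.1 (f s).2.2) (y := fun s => y s - A)
    (fun s x hx => ((hmemK x).1 hx).2 _ _ _ (hfn s) (hf0 s)) ?_ (fun s => ?_) (fun s => ?_)
    (fun s t hst => ?_) (fun s z hz hz0 => ?_)
  · refine LinearMap.ext fun x => ?_
    simp only [hf, slack, LinearMap.add_apply, LinearMap.sub_apply, Matrix.cons_val]
    ring
  · refine (hmemK _).2 ⟨hentry s, fun b i j h h0 => ?_⟩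
    rw [map_sub, h0, sub_zero]
    exact (hyP' s).2 b i j h
  · rw [map_sub, hf0, hy0, sub_zero]
  · rw [map_sub, hf0, sub_zero]
    exact hy1 s _ _ _ (hfn t) (hfinj s t hst)
  · have hz' : ∀ j < n, entry n 0 j z = 0 := by
      intro j hj
      have hle : Submodule.span ℝ K ≤ LinearMap.ker (entry n 0 j) :=
        Submodule.span_le.2 fun x hx => LinearMap.mem_ker.2 (((hmemK x).1 hx).1 j hj)
      exact LinearMap.mem_ker.1 (hle hz)
    obtain ⟨r, hr, hrle⟩ := exists_pos_mul_le
      (fun k : Bool × Fin n × Fin n => -slack n k.1 k.2.1 k.2.2 z)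
      (fun k => slack n k.1 k.2.1 k.2.2 (y s))
    refine ⟨r, hr, (hmemK _).2 ⟨fun j hj => ?_, fun b i' j' h' h0 => ?_⟩⟩
    · rw [map_add, hentry s j hj, map_smul, hz' j hj, smul_zero, add_zero]
    · rw [map_add, map_sub, h0, sub_zero, map_smul, smul_eq_mul]
      by_cases e : (b, i', j') = f s
      · have e1 : b = (f s).1 := congrArg Prod.fst e
        have e2 : i' = (f s).2.1 := congrArg (fun t => t.2.1) e
        have e3 : j' = (f s).2.2 := congrArg (fun t => t.2.2) e
        rw [e1, e2, e3, hy0, hz0, mul_zero, add_zero]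
      · have := hrle (b, ⟨i', by omega⟩, ⟨j', by omega⟩) (hy1 s b i' j' h' e)
        dsimp only at this
        linarith

end Simplicial

/-! ### Simplicial vertices and permutations -/

section Permutations

variable {n : ℕ}

/-- The sum of row `i` of a triangle. -/
def rowSum (n : ℕ) (v : ℕ → ℕ → ℤ) (i : ℕ) : ℤ := ∑ j ∈ Finset.range (n - i), v i j

theorem specHom_toTriangle (v : ℕ → ℕ → ℤ) (s : Fin n) :
    specHom n (toTriangle n v) s = rowSum n v s - rowSum n v (s + 1) := by
  have e1 : specHom n (toTriangle n v) =
      ∑ i ∈ Finset.range n, ∑ j ∈ Finset.range (n - i), v i j • rowExp n i := by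
    change ∑ k, toTriangle n v k • specExponent k = _
    rw [Finset.sum_sigma']
    refine Finset.sum_bij' (fun k _ => ⟨k.1.1, k.1.2⟩)
      (fun p hp => pos p.1 p.2 (by simp at hp; omega)) (fun k _ => ?_) (fun p hp => ?_)
      (fun k _ => rfl) (fun p hp => rfl) (fun k _ => ?_)
    · have := k.2
      simp
      omega
    · simp
    · induction k using Idx.induction with
      | h i j h =>
        rw [specExponent_pos]
        rfl
  have e2 : ∀ i, ∑ j ∈ Finset.range (n - i), v i j • rowExp n i = rowSum n v i • rowExp n i :=
    fun i => by rw [rowSum, Finset.sum_smul]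
  rw [e1, Finset.sum_congr rfl fun i _ => e2 i, Finset.sum_apply]
  simp only [Pi.smul_apply, rowExp, smul_eq_mul, mul_sub, Finset.sum_sub_distrib, mul_ite, mul_one,
    mul_zero, Finset.sum_ite_eq, Finset.mem_range, s.2, if_true]
  congr 1
  split_ifs with h
  · rfl
  · rw [rowSum, show n - (s + 1 : ℕ) = 0 by omega, Finset.sum_range_zero]

theorem specHom_of_deleted {v : ℕ → ℕ → ℤ} (s : Fin n) {d : ℕ} (hd : s + d < n)
    (h : ∀ k, (s : ℕ) + 1 + k < n → v (s + 1) k = v s (if k < d then k else k + 1)) :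
    specHom n (toTriangle n v) s = v s d := by
  rw [specHom_toTriangle, rowSum, rowSum, show n - (s : ℕ) = n - (s + 1) + 1 by omega,
    sum_range_succ_skip (show d ≤ n - (s + 1) by omega), sub_eq_iff_eq_add, add_right_inj]
  exact Finset.sum_congr rfl fun k hk => (h k (by have := Finset.mem_range.1 hk; omega)).symm

/-- A vertex triangle with strictly decreasing rows can be recovered from its weight. -/
theorem IsVertexTriangle.eq_of_specHom_eq {lam : Fin n → ℤ} {v v' : ℕ → ℕ → ℤ}
    (hv : IsVertexTriangle lam v) (hs : HasStrictRows n v) (hv' : IsVertexTriangle lam v')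
    (hs' : HasStrictRows n v')
    (h : specHom n (toTriangle n v) = specHom n (toTriangle n v')) : v = v' := by
  funext i
  induction i with
  | zero => rw [hv.row_zero, hv'.row_zero]
  | succ i ih =>
    funext k
    by_cases hk : i + 1 + k < n
    · have hi : i < n := by omega
      obtain ⟨d, hd, hdel⟩ := hv.exists_deleted hs hi
      obtain ⟨d', hd', hdel'⟩ := hv'.exists_deleted hs' hi
      have e := congrFun h ⟨i, hi⟩
      rw [specHom_of_deleted _ hd hdel, specHom_of_deleted _ hd' hdel'] at e
      dsimp only at e
      rw [← ih] at e
      have hdd : d = d' := by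
        rcases lt_trichotomy d d' with hlt | heq | hlt
        · have := hs.lt hlt hd'
          omega
        · exact heq
        · have := hs.lt hlt hd
          omega
      rw [hdel k hk, hdel' k hk, ih, hdd]
    · rw [hv.eq_zero _ _ (by omega), hv'.eq_zero _ _ (by omega)]

theorem IsVertexTriangle.exists_eq_lam {lam : Fin n → ℤ} {v : ℕ → ℕ → ℤ}
    (hv : IsVertexTriangle lam v) (i j : ℕ) (h : i + j < n) : ∃ m, v i j = lam m := by
  induction i generalizing j with
  | zero => exact ⟨⟨j, by omega⟩, by rw [hv.row_zero, topRow, dif_pos]⟩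
  | succ i ih =>
    rcases hv.step i j h with e | e <;> rw [e]
    · exact ih j (by omega)
    · exact ih (j + 1) (by omega)

/-- The weight of a vertex triangle with strictly decreasing rows is a permutation of `lam`: its
coordinates are the entries deleted in the passages from a row to the next one. -/
theorem IsVertexTriangle.exists_perm {lam : Fin n → ℤ} {v : ℕ → ℕ → ℤ}
    (hv : IsVertexTriangle lam v) (hs : HasStrictRows n v) :
    ∃ w : Equiv.Perm (Fin n), specHom n (toTriangle n v) = lam ∘ w.symm := by
  have hdel : ∀ s : Fin n, ∃ d, (s : ℕ) + d < n ∧ ∀ k, (s : ℕ) + 1 + k < n →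
      v (s + 1) k = v s (if k < d then k else k + 1) := fun s => hv.exists_deleted hs s.2
  choose d hd hdel using hdel
  have hD : ∀ s, specHom n (toTriangle n v) s = v s (d s) := fun s =>
    specHom_of_deleted s (hd s) (hdel s)
  -- A deleted entry does not occur in the later rows.
  have hne : ∀ (r : Fin n) (i : ℕ), (r : ℕ) + 1 ≤ i → ∀ j, i + j < n → v i j ≠ v r (d r) := by
    intro r i hi
    induction i, hi using Nat.le_induction with
    | base =>
      intro j hj
      rw [hdel r j hj]
      have := hd r
      split_ifs with h
      · exact (hs.lt h (hd r)).ne'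
      · exact (hs.lt (show d r < j + 1 by omega) (by omega)).ne
    | succ i hi ih =>
      intro j hj
      rcases hv.step i j hj with e | e <;> rw [e]
      · exact ih j (by omega)
      · exact ih (j + 1) (by omega)
  choose u hu using fun s : Fin n => hv.exists_eq_lam s (d s) (hd s)
  have hinj : Function.Injective u := by
    intro r s hrs
    by_contra h
    have e : v r (d r) = v s (d s) := by rw [hu, hu, hrs]
    rcases lt_or_gt_of_ne h with hlt | hlt
    · exact hne r s hlt (d s) (hd s) e.symm
    · exact hne s r hlt (d r) (hd r) e
  refine ⟨(Equiv.ofBijective u (Finite.injective_iff_bijective.1 hinj)).symm, ?_⟩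
  funext s
  rw [hD, hu]
  rfl

/-- The triangle in which row `i + 1` arises from row `i` by the deletion of the entry `t i`. -/
def deletionTriangle (lam : Fin n → ℤ) (t : ℕ → ℤ) : ℕ → ℕ → ℤ
  | 0, j => topRow lam j
  | i + 1, j => if i + 1 + j < n then
      (if t i < deletionTriangle lam t i j then deletionTriangle lam t i j
        else deletionTriangle lam t i (j + 1)) else 0

theorem exists_strict_triangle {lam : Fin n → ℤ} (hlam : StrictAnti lam)
    (w : Equiv.Perm (Fin n)) : ∃ v, IsVertexTriangle lam v ∧ HasStrictRows n v ∧
      specHom n (toTriangle n v) = lam ∘ w.symm := by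
  set t := topRow (lam ∘ w.symm) with ht
  set v := deletionTriangle lam t with hv
  have hsucc : ∀ i j, i + 1 + j < n → v (i + 1) j = if t i < v i j then v i j else v i (j + 1) :=
    fun i j h => if_pos h
  have htinj : ∀ r s, r < n → s < n → t r = t s → r = s := by
    intro r s hr hs h
    rw [ht, topRow, topRow, dif_pos hr, dif_pos hs] at h
    have := w.symm.injective (hlam.injective h)
    exact congrArg Fin.val this
  have hskip : ∀ i, (∀ j, i + 1 + j < n → v i (j + 1) < v i j) → ∀ k, i + k < n → v i k = t i →
      ∀ j, i + 1 + j < n → v (i + 1) j = v i (if j < k then j else j + 1) := by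
    intro i hrow k hk hkt j hj
    rw [hsucc i j hj]
    have hlt : ∀ j k, j < k → i + k < n → v i k < v i j := fun j k hjk hk =>
      lt_of_lt_of_forall_succ_lt (m := n - i) (fun j hj => hrow j (by omega)) hjk (by omega)
    by_cases hjk : j < k
    · rw [if_pos hjk, if_pos (by rw [← hkt]; exact hlt j k hjk hk)]
    · have : v i j ≤ t i := by
        rcases (not_lt.1 hjk).eq_or_lt with rfl | h
        · exact hkt.le
        · rw [← hkt]
          exact (hlt k j h (by omega)).le
      rw [if_neg hjk, if_neg (not_lt.2 this)]
  have main : ∀ i, (∀ j, i + 1 + j < n → v i (j + 1) < v i j) ∧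
      ∀ s, i ≤ s → s < n → ∃ k, i + k < n ∧ v i k = t s := by
    intro i
    induction i with
    | zero =>
      refine ⟨fun j hj => topRow_lt hlam (Nat.lt_succ_self j) (by omega), fun s _ hs => ?_⟩
      refine ⟨w.symm ⟨s, hs⟩, by omega, ?_⟩
      rw [ht, topRow, dif_pos hs]
      change topRow lam _ = _
      rw [topRow, dif_pos (w.symm ⟨s, hs⟩).2]
      rfl
    | succ i ih =>
      obtain ⟨hrow, hmem⟩ := ih
      refine ⟨fun j hj => ?_, fun s his hs => ?_⟩
      · obtain ⟨k, hk, hkt⟩ := hmem i le_rfl (by omega)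
        have h := hskip i hrow k hk hkt
        rw [h j (by omega), h (j + 1) (by omega)]
        refine lt_of_lt_of_forall_succ_lt (m := n - i) (fun j hj => hrow j (by omega)) ?_ ?_
        all_goals split_ifs <;> omega
      · obtain ⟨k, hk, hkt⟩ := hmem i le_rfl (by omega)
        obtain ⟨l, hl, hlt⟩ := hmem s (by omega) hs
        have h := hskip i hrow k hk hkt
        have hkl : l ≠ k := by
          rintro rfl
          have := htinj i s (by omega) hs (hkt.symm.trans hlt)
          omega
        rcases lt_or_gt_of_ne hkl with hlk | hlk
        · exact ⟨l, by omega, by rw [h l (by omega), if_pos hlk, hlt]⟩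
        · obtain ⟨l, rfl⟩ := Nat.exists_eq_succ_of_ne_zero (show l ≠ 0 by omega)
          exact ⟨l, by omega, by rw [h l (by omega), if_neg (by omega), ← hlt]⟩
  refine ⟨v, ⟨rfl, fun i j h => ?_, fun i j h => ?_⟩, fun i j h => (main i).1 j h, ?_⟩
  · rw [hsucc i j h]
    split_ifs
    · exact Or.inl rfl
    · exact Or.inr rfl
  · rcases i with _ | i
    · exact dif_neg (by omega)
    · exact if_neg (by omega)
  · funext s
    obtain ⟨k, hk, hkt⟩ := (main s).2 s le_rfl s.2
    rw [specHom_of_deleted s hk (hskip s (main s).1 k hk hkt), hkt, ht, topRow, dif_pos s.2]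

/-! ### The summands of Weyl's formula -/

theorem permRat_toRat_monomial (w : Equiv.Perm (Fin n)) (a : Fin n → ℤ) :
    permRat w (toRat (monomial a)) = toRat (monomial (a ∘ w.symm)) := by
  rw [permRat, toRat, IsFractionRing.ringEquivOfRingEquiv_algebraMap, permLaurent, monomial,
    AddMonoidAlgebra.mapDomainRingEquiv_single]
  rfl

theorem permRat_var (w : Equiv.Perm (Fin n)) (k : Fin n) : permRat w (var k) = var (w k) := by
  rw [var, permRat_toRat_monomial, var]
  congr 2
  funext s
  simp only [Function.comp_apply, Pi.single_apply]
  congr 1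
  rw [eq_iff_iff]
  exact w.symm_apply_eq

/-- A product over pairs, with factors symmetric in the pair, is invariant under permutations. -/
theorem prod_Ioi_comp_perm {M : Type} [CommMonoid M] (w : Equiv.Perm (Fin n))
    {H : Fin n → Fin n → M} (hH : ∀ a b, H a b = H b a) :
    ∏ i, ∏ j ∈ Finset.Ioi i, H (w i) (w j) = ∏ i, ∏ j ∈ Finset.Ioi i, H i j := by
  rw [Finset.prod_sigma', Finset.prod_sigma']
  refine Finset.prod_nbij'
    (fun p => if w p.1 < w p.2 then ⟨w p.1, w p.2⟩ else ⟨w p.2, w p.1⟩)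
    (fun p => if w.symm p.1 < w.symm p.2 then ⟨w.symm p.1, w.symm p.2⟩
      else ⟨w.symm p.2, w.symm p.1⟩) (fun p hp => ?_) (fun p hp => ?_) (fun p hp => ?_)
    (fun p hp => ?_) (fun p hp => ?_)
  all_goals
    obtain ⟨i, j⟩ := p
    have hij : i < j := by simpa using hp
  · have := w.injective.ne hij.ne
    dsimp only
    split_ifs with h
    · simpa using h
    · simpa using lt_of_le_of_ne (not_lt.1 h) this.symm
  · have := w.symm.injective.ne hij.ne
    dsimp only
    split_ifs with h
    · simpa using h
    · simpa using lt_of_le_of_ne (not_lt.1 h) this.symm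
  · dsimp only
    split_ifs with h h' h' <;> simp_all [hij.asymm]
  · dsimp only
    split_ifs with h h' h' <;> simp_all [hij.asymm]
  · dsimp only
    split_ifs with h
    · rfl
    · exact hH _ _

theorem varExp_eq_single (s : Fin n) : varExp n s = Pi.single s 1 := by
  funext k
  rw [varExp, Pi.single_apply]
  simp only [Fin.ext_iff]

theorem geom_expo_sub (r s : Fin n) :
    geom (expo (Fin n)) (varExp n s - varExp n r) = (1 - var s / var r)⁻¹ := by
  rw [geom, sub_eq_add_neg (varExp n s), ofAdd_add, map_mul, ofAdd_neg, map_inv, expo_ofAdd,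
    expo_ofAdd, varExp_eq_single, varExp_eq_single, div_eq_mul_inv]
  rfl

/-- The value of the tangent cone at a vertex with strictly decreasing rows is a summand of Weyl's
formula. -/
theorem vertexValue_eq_permRat_weylTerm {lam : Fin n → ℤ} (hlam : StrictAnti lam)
    {v : ℕ → ℕ → ℤ} (hv : IsVertexTriangle lam v) (hs : HasStrictRows n v)
    (w : Equiv.Perm (Fin n)) (hw : specHom n (toTriangle n v) = lam ∘ w.symm) :
    vertexValue lam v = permRat w (weylTerm lam) := by
  have hdel : ∀ i, ∃ d, i < n → i + d < n ∧ ∀ k, i + 1 + k < n →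
      v (i + 1) k = v i (if k < d then k else k + 1) := fun i => by
    by_cases hi : i < n
    · obtain ⟨d, hd⟩ := hv.exists_deleted hs hi
      exact ⟨d, fun _ => hd⟩
    · exact ⟨0, fun h => absurd h hi⟩
  choose d hdel using hdel
  have hD : ∀ s : Fin n, v s (d s) = lam (w.symm s) := fun s => by
    rw [← specHom_of_deleted s (hdel s s.2).1 (hdel s s.2).2, hw]
    rfl
  -- The image under `w` of the factor of Weyl's formula for a pair, made symmetric in the pair.
  set H : Fin n → Fin n → RatFun (Fin n) := fun a b =>
    if w.symm a < w.symm b then (1 - var b / var a)⁻¹ else (1 - var a / var b)⁻¹ with hH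
  have hHsymm : ∀ a b, H a b = H b a := by
    intro a b
    simp only [hH]
    rcases lt_trichotomy (w.symm a) (w.symm b) with h | h | h
    · rw [if_pos h, if_neg h.asymm]
    · rw [w.symm.injective h]
    · rw [if_neg h.asymm, if_pos h]
  have hfactor : ∀ r s : Fin n, r < s →
      denomFactor (v r (d r)) (v s (d s)) (varExp n s - varExp n r) = H r s := by
    intro r s hrs
    rw [hD, hD, denomFactor, neg_sub, geom_expo_sub, geom_expo_sub]
    simp only [hH, hlam.lt_iff_gt]
    rcases lt_trichotomy (w.symm r) (w.symm s) with h | h | h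
    · rw [if_neg h.asymm, if_pos h]
    · exact absurd (w.symm.injective h) hrs.ne
    · rw [if_pos h, if_neg h.asymm]
  have hprod : ∏ s ∈ Finset.range n, ∏ r ∈ Finset.range s,
      denomFactor (v r (d r)) (v s (d s)) (varExp n s - varExp n r) =
      ∏ i, ∏ j ∈ Finset.Ioi i, H i j := by
    rw [Finset.prod_range, Finset.prod_sigma', Finset.prod_sigma']
    refine Finset.prod_bij' (fun p hp => ⟨⟨p.2, ?_⟩, p.1⟩) (fun p _ => ⟨p.2, p.1⟩)
      (fun p hp => ?_) (fun p hp => ?_) (fun p hp => rfl) (fun p hp => rfl) (fun p hp => ?_)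
    · have := (Finset.mem_sigma.1 hp).2
      rw [Finset.mem_range] at this
      exact this.trans p.1.2
    · have := (Finset.mem_sigma.1 hp).2
      rw [Finset.mem_range] at this
      simpa [Fin.lt_def] using this
    · have := (Finset.mem_sigma.1 hp).2
      rw [Finset.mem_Ioi] at this
      exact Finset.mem_sigma.2 ⟨Finset.mem_univ _, Finset.mem_range.2 this⟩
    · have := (Finset.mem_sigma.1 hp).2
      rw [Finset.mem_range] at this
      exact hfactor ⟨p.2, this.trans p.1.2⟩ p.1 this
  have hexp : ∑ r ∈ Finset.range n, v r (d r) • varExp n r = lam ∘ w.symm := by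
    rw [Finset.sum_range]
    funext s
    rw [Finset.sum_apply, Finset.sum_eq_single s]
    · rw [Pi.smul_apply, varExp_eq_single, Pi.single_eq_same, hD, smul_eq_mul, mul_one]
      rfl
    · intro r _ hr
      rw [Pi.smul_apply, varExp_eq_single, Pi.single_eq_of_ne hr.symm, smul_zero]
    · exact fun h => absurd (Finset.mem_univ s) h
  rw [vertexValue_of_hasStrictRows hv hs (fun i hi => (hdel i hi).1) (fun i hi => (hdel i hi).2),
    hprod, hexp, expo_ofAdd, ← prod_Ioi_comp_perm w hHsymm, weylTerm, map_div₀,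
    permRat_toRat_monomial, div_eq_mul_inv, map_prod, ← Finset.prod_inv_distrib]
  congr 1
  refine Finset.prod_congr rfl fun i _ => ?_
  rw [map_prod, ← Finset.prod_inv_distrib]
  refine Finset.prod_congr rfl fun j hj => ?_
  rw [map_sub, map_one, map_div₀, permRat_var, permRat_var]
  simp [hH, Finset.mem_Ioi.1 hj]

end Permutations

/-! ### The transforms of the polytope and of its tangent cones -/

section Transforms

variable {n : ℕ} {lam : Fin n → ℤ}

theorem entry_toReal_apply (y : Idx n → ℤ) {i j : ℕ} (h : i + j < n) :
    entry n i j (toReal y) = (y (pos i j h) : ℝ) := entry_apply h _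

theorem slack_toReal_nonneg_iff (y : Idx n → ℤ) {i j : ℕ} (h : i + 1 + j < n) :
    (0 ≤ slack n false i j (toReal y) ↔ y (pos (i + 1) j h) ≤ y (pos i j (by omega))) ∧
    (0 ≤ slack n true i j (toReal y) ↔ y (pos i (j + 1) (by omega)) ≤ y (pos (i + 1) j h)) := by
  constructor
  · rw [slack, LinearMap.sub_apply, sub_nonneg, entry_toReal_apply y h,
      entry_toReal_apply y (show i + j < n by omega), Int.cast_le]
  · rw [slack, LinearMap.sub_apply, sub_nonneg, entry_toReal_apply y h,
      entry_toReal_apply y (show i + (j + 1) < n by omega), Int.cast_le]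

theorem entry_zero_toReal_eq_iff (y : Idx n → ℤ) :
    (∀ j < n, entry n 0 j (toReal y) = topRow lam j) ↔
      ∀ j h, y (pos 0 j h) = topRow lam j := by
  refine ⟨fun H j h => ?_, fun H j h => ?_⟩
  · have := H j (by omega)
    rw [entry_toReal_apply y h] at this
    exact_mod_cast this
  · rw [entry_toReal_apply y (show 0 + j < n by omega), H j (by omega)]

/-- The tangent cone at a vertex has a specialized transform: an entry is bounded by those entries
above it to which it is equal at the vertex. -/
theorem tangentCone_transform (hlam : StrictAnti lam) {v : ℕ → ℕ → ℤ}
    (hv : IsVertexTriangle lam v) :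
    (∃ Q, IsTransform (tangentCone (GTPolytope lam) (toReal (toTriangle n v))) Q) ∧
    (∃ S, IsSpecialization
      (transform (tangentCone (GTPolytope lam) (toReal (toTriangle n v)))) S) ∧
    specRat (transform (tangentCone (GTPolytope lam) (toReal (toTriangle n v)))) =
      vertexValue lam v := by
  refine specRat_transform_eq_triangleValue
    (fun j h => (topRow_lt hlam (Nat.lt_succ_self j) h).le) hv.step
    (fun i j h hL hR => hv.tied hlam h hL hR) fun y => ?_
  rw [mem_tangentCone_iff (hv.mem_GTPolytope hlam), entry_zero_toReal_eq_iff]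
  refine and_congr_right fun _ => ⟨fun H i j h => ?_, fun H b i j h h0 => ?_⟩
  · rw [← (slack_toReal_nonneg_iff y h).1, ← (slack_toReal_nonneg_iff y h).2]
    refine ⟨fun e => H _ i j h ?_, fun e => H _ i j h ?_⟩
    · rw [(slack_toReal v h).1, e, sub_self, Int.cast_zero]
    · rw [(slack_toReal v h).2, e, sub_self, Int.cast_zero]
  · cases b
    · rw [(slack_toReal v h).1, Int.cast_eq_zero, sub_eq_zero] at h0
      exact (slack_toReal_nonneg_iff y h).1.2 ((H i j h).1 h0.symm)
    · rw [(slack_toReal v h).2, Int.cast_eq_zero, sub_eq_zero] at h0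
      exact (slack_toReal_nonneg_iff y h).2.2 ((H i j h).2 h0)

theorem GTPolytope_transform (hlam : StrictAnti lam) :
    (∃ Q, IsTransform (GTPolytope lam) Q) ∧
    (∃ S, IsSpecialization (transform (GTPolytope lam)) S) ∧
    specRat (transform (GTPolytope lam)) = ∑ v ∈ truncatedVertices lam n, vertexValue lam v := by
  rw [← triangleValue_eq_sum]
  refine specRat_transform_eq_triangleValue
    (fun j h => (topRow_lt hlam (Nat.lt_succ_self j) h).le) (fun _ _ _ => Or.inl trivial)
    (fun _ _ _ _ _ => ⟨trivial, trivial⟩) fun y => ?_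
  rw [mem_GTPolytope_iff, entry_zero_toReal_eq_iff]
  simp only [Bool.forall_bool, forall_true_left]
  refine and_congr_right fun _ => ⟨fun H i j h => ?_, fun H => ⟨fun i j h => ?_, fun i j h => ?_⟩⟩
  · exact ⟨(slack_toReal_nonneg_iff y h).1.1 (H.1 i j h),
      (slack_toReal_nonneg_iff y h).2.1 (H.2 i j h)⟩
  · exact (slack_toReal_nonneg_iff y h).1.2 (H i j h).1
  · exact (slack_toReal_nonneg_iff y h).2.2 (H i j h).2

theorem isSimplicialVertex_iff (hlam : StrictAnti lam) {x : Idx n → ℝ} :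
    IsSimplicialVertex (GTPolytope lam) x ↔
      ∃ v, IsVertexTriangle lam v ∧ HasStrictRows n v ∧ toReal (toTriangle n v) = x := by
  constructor
  · intro h
    obtain ⟨v, hv, rfl⟩ := (mem_vertices_iff hlam).1 h.1
    exact ⟨v, hv, hasStrictRows_of_isSimplicialVertex hlam hv h, rfl⟩
  · rintro ⟨v, hv, hs, rfl⟩
    exact isSimplicialVertex_of_hasStrictRows hlam hv hs

theorem toReal_injective {κ : Type} : Function.Injective (toReal (κ := κ)) :=
  fun _ _ h => funext fun k => Int.cast_injective (congrFun h k)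

theorem specRat_toRat_monomial (a : Idx n → ℤ) :
    specRat (toRat (monomial a)) = toRat (monomial (specHom n a)) := by
  refine IsSpecialization.specRat_eq ⟨1, monomial a, ?_, ?_, ?_⟩
  · rw [map_one]
    exact one_ne_zero
  · rw [toRat, toRat, map_one, div_one]
  · simp only [toRat, map_one, div_one, monomial, specLaurent,
      AddMonoidAlgebra.mapDomainRingHom_apply, AddMonoidAlgebra.mapDomain_single]

theorem specRat_toRat_monomial_eq_iff (w : Equiv.Perm (Fin n)) (a : Idx n → ℤ) :
    specRat (toRat (monomial a)) = permRat w (toRat (monomial lam)) ↔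
      specHom n a = lam ∘ w.symm := by
  rw [specRat_toRat_monomial, permRat_toRat_monomial]
  refine ⟨fun h => ?_, fun h => by rw [h]⟩
  exact AddMonoidAlgebra.single_left_injective one_ne_zero
    (IsFractionRing.injective (Laurent (Fin n)) (RatFun (Fin n)) h)

end Transforms

end GelfandTsetlin

end

open GelfandTsetlin in
theorem mainTheorem1 (n : ℕ) (lam : Fin n → ℤ) (hdom : Antitone lam)
    (hreg : Function.Injective lam) :
    -- there are exactly `n!` simplicial vertices
    {v | IsSimplicialVertex (GTPolytope lam) v}.ncard = n.factorial ∧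
    -- for every permutation `w` exactly one of them satisfies `F(t ^ v) = w(e ^ lam)`
    (∀ w : Equiv.Perm (Fin n), ∃! v : Idx n → ℝ, IsSimplicialVertex (GTPolytope lam) v ∧
      ∃ a : Idx n → ℤ, toReal a = v ∧
        specRat (toRat (monomial a)) = permRat w (toRat (monomial lam))) ∧
    -- `σ(C_v)` and `F(σ(C_v))` are defined for every vertex `v`
    (∀ v ∈ vertices (GTPolytope lam),
      (∃ Q, IsTransform (tangentCone (GTPolytope lam) v) Q) ∧
      ∃ R, IsSpecialization (transform (tangentCone (GTPolytope lam) v)) R) ∧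
    -- the contribution of the simplicial vertex that corresponds to `w`
    (∀ (w : Equiv.Perm (Fin n)) (a : Idx n → ℤ),
      IsSimplicialVertex (GTPolytope lam) (toReal a) →
      specRat (toRat (monomial a)) = permRat w (toRat (monomial lam)) →
      specRat (transform (tangentCone (GTPolytope lam) (toReal a))) =
        permRat w (weylTerm lam)) ∧
    -- the contribution of a non-simplicial vertex
    (∀ v ∈ vertices (GTPolytope lam), ¬ IsSimplicialVertex (GTPolytope lam) v →
      specRat (transform (tangentCone (GTPolytope lam) v)) = 0) ∧
    -- the specialization of Brion's formula for the polytope is Weyl's character formula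
    ((∃ Q, IsTransform (GTPolytope lam) Q) ∧
      (∃ R, IsSpecialization (transform (GTPolytope lam)) R) ∧
      (vertices (GTPolytope lam)).Finite ∧
      specRat (transform (GTPolytope lam)) =
        ∑ᶠ v ∈ vertices (GTPolytope lam),
          specRat (transform (tangentCone (GTPolytope lam) v)) ∧
      specRat (transform (GTPolytope lam)) =
        ∑ w : Equiv.Perm (Fin n), permRat w (weylTerm lam)) := by
  classical
  have hlam : StrictAnti lam := hdom.strictAnti_of_injective hreg
  -- `V w` is the vertex with strictly decreasing rows that corresponds to the permutation `w`.
  choose V hV hVs hVw using exists_strict_triangle hlam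
  have hVinj : Function.Injective V := fun w w' h => by
    have e : lam ∘ w.symm = lam ∘ w'.symm := by rw [← hVw, ← hVw, h]
    have : w.symm = w'.symm := Equiv.ext fun k => hreg (congrFun e k)
    simpa using congrArg Equiv.symm this
  have hVsurj : ∀ v, IsVertexTriangle lam v → HasStrictRows n v → ∃ w, V w = v := fun v hv hs => by
    obtain ⟨w, hw⟩ := hv.exists_perm hs
    exact ⟨w, (hV w).eq_of_specHom_eq (hVs w) hv hs ((hVw w).trans hw.symm)⟩
  have hvert : vertices (GTPolytope lam) =
      ↑((truncatedVertices lam n).image fun v => toReal (toTriangle n v)) := by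
    ext x
    simp only [mem_vertices_iff hlam, Finset.coe_image, Set.mem_image, SetLike.mem_coe,
      mem_truncatedVertices_iff]
  obtain ⟨hG1, hG2, hG3⟩ := GTPolytope_transform hlam
  refine ⟨?_, fun w => ?_, fun x hx => ?_, fun w a ha haw => ?_, fun x hx hns => ?_,
    hG1, hG2, ?_, ?_, ?_⟩
  · have hrange : {x | IsSimplicialVertex (GTPolytope lam) x} =
        Set.range fun w => toReal (toTriangle n (V w)) := by
      ext x
      refine (isSimplicialVertex_iff hlam).trans ?_
      constructor
      · rintro ⟨v, hv, hs, rfl⟩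
        obtain ⟨w, rfl⟩ := hVsurj v hv hs
        exact ⟨w, rfl⟩
      · rintro ⟨w, rfl⟩
        exact ⟨V w, hV w, hVs w, rfl⟩
    have hinj : Function.Injective fun w => toReal (toTriangle n (V w)) :=
      fun w w' h => hVinj ((hV w).toReal_injective (hV w') h)
    rw [hrange, ← Set.image_univ, Set.ncard_image_of_injective _ hinj, Set.ncard_univ,
      Nat.card_perm, Nat.card_fin]
  · refine ⟨toReal (toTriangle n (V w)), ⟨(isSimplicialVertex_iff hlam).2
      ⟨V w, hV w, hVs w, rfl⟩, _, rfl, (specRat_toRat_monomial_eq_iff w _).2 (hVw w)⟩, ?_⟩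
    rintro x ⟨hx, a, rfl, ha⟩
    obtain ⟨v, hv, hs, he⟩ := (isSimplicialVertex_iff hlam).1 hx
    have ha' := (specRat_toRat_monomial_eq_iff w a).1 ha
    rw [← toReal_injective he] at ha' ⊢
    rw [hv.eq_of_specHom_eq hs (hV w) (hVs w) (ha'.trans (hVw w).symm)]
  · obtain ⟨v, hv, rfl⟩ := (mem_vertices_iff hlam).1 hx
    obtain ⟨h1, h2, -⟩ := tangentCone_transform hlam hv
    exact ⟨h1, h2⟩
  · obtain ⟨v, hv, hs, he⟩ := (isSimplicialVertex_iff hlam).1 ha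
    have ha' := (specRat_toRat_monomial_eq_iff w a).1 haw
    rw [← toReal_injective he] at ha' ⊢
    rw [(tangentCone_transform hlam hv).2.2, vertexValue_eq_permRat_weylTerm hlam hv hs w ha']
  · obtain ⟨v, hv, rfl⟩ := (mem_vertices_iff hlam).1 hx
    rw [(tangentCone_transform hlam hv).2.2]
    exact vertexValue_eq_zero hlam hv fun hs =>
      hns ((isSimplicialVertex_iff hlam).2 ⟨v, hv, hs, rfl⟩)
  · rw [hvert]
    exact Finset.finite_toSet _
  · rw [hvert, hG3, finsum_mem_coe_finset, Finset.sum_image fun v hv v' hv' h =>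
      (mem_truncatedVertices_iff.1 hv).toReal_injective (mem_truncatedVertices_iff.1 hv') h]
    exact Finset.sum_congr rfl fun v hv =>
      (tangentCone_transform hlam (mem_truncatedVertices_iff.1 hv)).2.2.symm
  -- The vertices other than the `V w` contribute zero.
  · rw [hG3, ← Finset.sum_subset (s₁ := Finset.univ.image V), Finset.sum_image hVinj.injOn]
    · exact Finset.sum_congr rfl fun w _ =>
        vertexValue_eq_permRat_weylTerm hlam (hV w) (hVs w) w (hVw w)
    · intro v hv
      obtain ⟨w, -, rfl⟩ := Finset.mem_image.1 hv
      exact mem_truncatedVertices_iff.2 (hV w)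
    · intro v hv hv'
      have hv := mem_truncatedVertices_iff.1 hv
      refine vertexValue_eq_zero hlam hv fun hs => hv' ?_
      obtain ⟨w, rfl⟩ := hVsurj v hv hs
      exact Finset.mem_image_of_mem V (Finset.mem_univ w)
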